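/- **Setting.** Let $C_1,\dots,C_n$ be pairwise disjoint unit circles in the plane (the trajectories) and $\epsilon<1/2$ (the communication range). Let $G$ be a connected graph on $\{1,\dots,n\}$ (the communication graph) such that the centres of $C_i$ and $C_j$ are at distance at most $2+\epsilon$ for every edge $\{i,j\}$ of $G$. A schedule assigns to $C_i$ a starting angle $f_i\in[0,2\pi)$ and a direction $g_i\in\{1,-1\}$; the scheduled position in $C_i$ at time $t$ is the point of $C_i$ with angle $f_i+2\pi g_i t$. The link position $\phi_{ij}$ is the point of $C_i$ closest to $C_j$. These data form a *synchronized communication system* (SCS) if, for every edge $\{i,j\}$ of $G$, $g_i=-g_j$ and, at every time, the scheduled position in $C_i$ is $\phi_{ij}$ if and only if the scheduled position in $C_j$ is $\phi_{ji}$. One robot starts in each $C_i$ at time $0$ and follows the schedule. When a set $R$ of robots has left at time $0$, each surviving robot that arrives at a link position $\phi_{ij}$ while no surviving robot is at $\phi_{ji}$ shifts (instantaneously) to $C_j$ and follows the schedule there. A surviving robot *starves* if, every time that it arrives at a link position $\phi_{ij}$, no surviving robot is at $\phi_{ji}$. For $k\ge 1$ the *$k$-resilience* is the minimum of $|R|$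 over all sets $R$ of robots such that at least $k$ surviving robots starve when $R$ has left, and $\infty$ if there is no such $R$. The *ring* of a robot is the path obtained from its starting position by following the schedule and always shifting to the neighbouring trajectory at the link positions. The *meeting graph* has the robots as vertices; $u$ and $v$ are adjacent if there are an edge $\{i,j\}$ of $G$ and two paths of equal lengths, one along the ring of $u$ from its starting position arriving at $\phi_{ij}$ in $C_i$, the other along the ring of $v$ from its starting position arriving at $\phi_{ji}$ in $C_j$ (paths may be longer than the ring; shifts have length $0$). **Machine model.** A real RAM with integer and real registers and arrays and unit-cost operations: addition, truncated subtraction and comparison of natural numbers; exact $+,-,\times,\div$ and comparison of real numbers; array accesses indexed by natural numbers. The input consists of $n$, $k$, $\epsilon$, the adjacency matrix of $G$, the directions $g_i$, and the Cartesian coordinates of the centres and of the vectors from the centres to the starting positions, i.e. $(\cos f_i,\sin f_i)$. **Theorem.** There is a single algorithm on this machine that, for every SCS of $n$ robots and every $k\ge 1$, computes the $k$-resilience in $O(kn^{k+1})$ time. It runs in two phases, the first of which computes the meeting graph in $O(n^2)$ time. The implied constants are absolute (independent of $n$, $k$ and the system). -/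

import Mathlib

/-- A synchronized communication system of `n` robots, one on each of `n` pairwise disjoint unit
circles in the plane `ℂ`. -/
structure SCS (n : ℕ) where
  /-- the centre of the trajectory `C_i` -/
  center : Fin n → ℂ
  /-- the communication range -/
  ε : ℝ
  /-- the communication graph -/
  G : SimpleGraph (Fin n)
  /-- the starting angle of the robot of `C_i` -/
  f : Fin n → ℝ
  /-- the direction of movement in `C_i`: `1` is counterclockwise, `-1` is clockwise -/
  g : Fin n → ℤ
  disjoint : ∀ i j, i ≠ j → Disjoint (Metric.sphere (center i) 1) (Metric.sphere (center j) 1)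
  ε_lt : ε < 1 / 2
  dist_le : ∀ i j, G.Adj i j → dist (center i) (center j) ≤ 2 + ε
  connected : G.Connected
  f_mem : ∀ i, f i ∈ Set.Ico 0 (2 * Real.pi)
  g_eq : ∀ i, g i = 1 ∨ g i = -1
  /-- neighbouring trajectories have opposite directions -/
  g_neg : ∀ i j, G.Adj i j → g i = -g j
  /-- the schedule is `G`-synchronized: at every time, the scheduled position in `C_i` is the point
  of `C_i` closest to `C_j` if and only if the scheduled position in `C_j` is the point of `C_j`
  closest to `C_i` -/
  sync : ∀ i j, G.Adj i j → ∀ t : ℝ,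
    circleMap (center i) 1 (f i + 2 * Real.pi * g i * t) =
        center i + (center j - center i) / (‖center j - center i‖ : ℂ) ↔
      circleMap (center j) 1 (f j + 2 * Real.pi * g j * t) =
        center j + (center i - center j) / (‖center i - center j‖ : ℂ)

namespace SCS

variable {n : ℕ} (S : SCS n)

/-- The point of the circle `C_i` at which the schedule puts a robot at time `t`. -/
noncomputable def position (i : Fin n) (t : ℝ) : ℂ :=
  circleMap (S.center i) 1 (S.f i + 2 * Real.pi * S.g i * t)

/-- The link position of `C_i` with respect to `C_j`: the point of `C_i` closest to `C_j`. -/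
noncomputable def link (i j : Fin n) : ℂ :=
  S.center i + (S.center j - S.center i) / (‖S.center j - S.center i‖ : ℂ)

/-- The times in `[0, t)` at which the schedule reaches some link position. -/
def eventSet (t : ℝ) : Set ℝ :=
  {s | s ∈ Set.Ico 0 t ∧ ∃ i j, S.G.Adj i j ∧ S.position i s = S.link i j}

theorem finite_eventSet (t : ℝ) : (S.eventSet t).Finite := by
  have key : ∀ i j, {s | s ∈ Set.Ico 0 t ∧ S.position i s = S.link i j}.Finite := by
    intro i j
    rcases Set.eq_empty_or_nonempty {s | s ∈ Set.Ico 0 t ∧ S.position i s = S.link i j}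
      with h | ⟨s₀, hs₀, hp₀⟩
    · rw [h]; exact Set.finite_empty
    · refine ((Set.finite_Icc (⌊-t⌋) (⌈t⌉)).image (fun m : ℤ => s₀ + m)).subset ?_
      rintro s ⟨hs, hp⟩
      have h := hp.trans hp₀.symm
      unfold position at h
      rw [circleMap_eq_circleMap_iff _ one_ne_zero] at h
      obtain ⟨m, hm⟩ := h
      have hm' : S.f i + 2 * Real.pi * S.g i * s =
          S.f i + 2 * Real.pi * S.g i * s₀ + m * (2 * Real.pi) := by
        have h2 := congrArg Complex.im hm
        simpa using h2
      have h3 : (S.g i : ℝ) * (s - s₀) = m := by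
        have hpi := Real.pi_pos
        have : 2 * Real.pi * ((S.g i : ℝ) * (s - s₀)) = 2 * Real.pi * m := by linarith
        exact mul_left_cancel₀ (by positivity) this
      have hg : (S.g i : ℝ) * S.g i = 1 := by
        rcases S.g_eq i with h | h <;> simp [h]
      have h4 : s = s₀ + ((S.g i * m : ℤ) : ℝ) := by
        push_cast
        rw [← h3, ← mul_assoc, hg]; ring
      refine ⟨S.g i * m, ?_, h4.symm⟩
      have h5 : ((S.g i * m : ℤ) : ℝ) = s - s₀ := by linarith
      constructor
      · have : ((⌊-t⌋ : ℤ) : ℝ) ≤ ((S.g i * m : ℤ) : ℝ) := by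
          rw [h5]; linarith [Int.floor_le (-t), hs.1, hs₀.2]
        exact_mod_cast this
      · have : ((S.g i * m : ℤ) : ℝ) ≤ ((⌈t⌉ : ℤ) : ℝ) := by
          rw [h5]; linarith [Int.le_ceil t, hs.2, hs₀.1]
        exact_mod_cast this
  refine (Set.finite_iUnion fun i => Set.finite_iUnion fun j => key i j).subset ?_
  rintro s ⟨hs, i, j, -, h⟩
  simp only [Set.mem_iUnion]
  exact ⟨i, j, hs, h⟩

/-- The times in `[0, t)` at which the schedule reaches some link position, in increasing order. -/
noncomputable def events (t : ℝ) : List ℝ :=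
  (S.finite_eventSet t).toFinset.sort (· ≤ ·)

open Classical in
/-- The shifting protocol at time `τ`, when the robots of `R` have left the team: if a robot `u` in
`C_i` is at the link position with respect to a neighbour `C_j`, and no surviving robot is at the
link position of `C_j` with respect to `C_i`, then `u` shifts to `C_j`. Here `loc u` is the
trajectory of the robot `u`. -/
noncomputable def shift (R : Finset (Fin n)) (loc : Fin n → Fin n) (τ : ℝ) : Fin n → Fin n :=
  fun u =>
    if h : ∃ j, S.G.Adj (loc u) j ∧ S.position (loc u) τ = S.link (loc u) j ∧
        ∀ v, v ∉ R → S.position (loc v) τ ≠ S.link j (loc u)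
    then h.choose else loc u

/-- The trajectory in which the robot `u` arrives at time `t` (before any shift at time `t`), when
the robots of `R` leave the team at time `0`; the robot `u` starts in `C_u`. -/
noncomputable def loc (R : Finset (Fin n)) (t : ℝ) : Fin n → Fin n :=
  (S.events t).foldl (S.shift R) id

/-- The robot `u` starves in the partial system in which the robots of `R` have left: every time
that it arrives at a link position, no surviving robot is at the corresponding link position of the
neighbouring trajectory. -/
def Starves (R : Finset (Fin n)) (u : Fin n) : Prop :=
  ∀ t : ℝ, 0 ≤ t → ∀ j, S.G.Adj (S.loc R t u) j →
    S.position (S.loc R t u) t = S.link (S.loc R t u) j →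
      ∀ v, v ∉ R → S.position (S.loc R t v) t ≠ S.link j (S.loc R t u)

open Classical in
/-- The surviving robots that starve when the robots of `R` leave the team. -/
noncomputable def starving (R : Finset (Fin n)) : Finset (Fin n) :=
  {u | u ∉ R ∧ S.Starves R u}

/-- The `k`-resilience: the minimum number of robots whose removal causes the starvation of at least
`k` surviving robots, and `⊤` if this is not possible. -/
noncomputable def resilience (k : ℕ) : ℕ∞ :=
  ⨅ (R : Finset (Fin n)) (_ : k ≤ (S.starving R).card), (R.card : ℕ∞)

open Classical in
/-- One step along a ring: at a link position, always shift to the neighbouring trajectory. -/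
noncomputable def cross (i : Fin n) (τ : ℝ) : Fin n :=
  if h : ∃ j, S.G.Adj i j ∧ S.position i τ = S.link i j then h.choose else i

/-- The trajectory reached at time `t` from the starting position of the robot `u` by following its
ring, that is, by traversing a path of length `2πt` in this ring. -/
noncomputable def ring (u : Fin n) (t : ℝ) : Fin n :=
  (S.events t).foldl S.cross u

/-- The meeting graph: `u` and `v` are adjacent when they prevent each other from starving, that is,
when there are a link between two trajectories `C_i` and `C_j` and two paths of equal lengths
(`2πt`) to this link, one along the ring of `u` arriving in `C_i` and the other along the ring of
`v` arriving in `C_j`. -/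
noncomputable def meetingGraph : SimpleGraph (Fin n) where
  Adj u v := ∃ t : ℝ, 0 ≤ t ∧ S.G.Adj (S.ring u t) (S.ring v t) ∧
    S.position (S.ring u t) t = S.link (S.ring u t) (S.ring v t)
  symm := ⟨fun _ _ ⟨t, ht, ha, hp⟩ => ⟨t, ht, ha.symm, (S.sync _ _ ha t).1 hp⟩⟩
  loopless := ⟨fun _ ⟨_, _, ha, _⟩ => S.G.loopless.irrefl _ ha⟩

end SCS

/-! A real random access machine, programmed in a small structured language. There are integer
registers and real registers, integer arrays and real arrays (indexed by integers only). Real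
arithmetic and comparisons are exact, there is no rounding of reals to integers, and integers can
only be added, subtracted and compared. Every operation has unit cost. -/

namespace RealRAM

/-- The memory; a program only addresses the finitely many registers and arrays it names. -/
structure Mem where
  intReg : ℕ → ℕ
  intArr : ℕ → ℕ → ℕ
  realReg : ℕ → ℝ
  realArr : ℕ → ℕ → ℝ

/-- Integer expressions. -/
inductive IntExp where
  | const (c : ℕ)
  | reg (x : ℕ)
  | arr (a : ℕ) (e : IntExp)
  | add (e₁ e₂ : IntExp)
  | sub (e₁ e₂ : IntExp)

/-- Real expressions. -/
inductive RealExp where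
  | const (c : ℤ)
  | reg (x : ℕ)
  | arr (a : ℕ) (e : IntExp)
  | add (e₁ e₂ : RealExp)
  | sub (e₁ e₂ : RealExp)
  | mul (e₁ e₂ : RealExp)
  | div (e₁ e₂ : RealExp)

/-- Tests. -/
inductive Test where
  | intEq (e₁ e₂ : IntExp)
  | intLt (e₁ e₂ : IntExp)
  | realEq (e₁ e₂ : RealExp)
  | realLt (e₁ e₂ : RealExp)
  | not (b : Test)
  | and (b₁ b₂ : Test)

/-- Programs. -/
inductive Program where
  | skip
  | setInt (x : ℕ) (e : IntExp)
  | setReal (x : ℕ) (e : RealExp)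
  | storeInt (a : ℕ) (i e : IntExp)
  | storeReal (a : ℕ) (i : IntExp) (e : RealExp)
  | seq (p q : Program)
  | ite (b : Test) (p q : Program)
  | while (b : Test) (p : Program)

/-- Subtraction of integers is truncated at `0`. -/
def IntExp.eval (m : Mem) : IntExp → ℕ
  | const c => c
  | reg x => m.intReg x
  | arr a e => m.intArr a (e.eval m)
  | add e₁ e₂ => e₁.eval m + e₂.eval m
  | sub e₁ e₂ => e₁.eval m - e₂.eval m

/-- The number of operations in an integer expression. -/
def IntExp.cost : IntExp → ℕ
  | const _ => 1
  | reg _ => 1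
  | arr _ e => e.cost + 1
  | add e₁ e₂ => e₁.cost + e₂.cost + 1
  | sub e₁ e₂ => e₁.cost + e₂.cost + 1

/-- Division by zero returns zero. -/
noncomputable def RealExp.eval (m : Mem) : RealExp → ℝ
  | const c => c
  | reg x => m.realReg x
  | arr a e => m.realArr a (e.eval m)
  | add e₁ e₂ => e₁.eval m + e₂.eval m
  | sub e₁ e₂ => e₁.eval m - e₂.eval m
  | mul e₁ e₂ => e₁.eval m * e₂.eval m
  | div e₁ e₂ => e₁.eval m / e₂.eval m

/-- The number of operations in a real expression. -/
def RealExp.cost : RealExp → ℕ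
  | const _ => 1
  | reg _ => 1
  | arr _ e => e.cost + 1
  | add e₁ e₂ => e₁.cost + e₂.cost + 1
  | sub e₁ e₂ => e₁.cost + e₂.cost + 1
  | mul e₁ e₂ => e₁.cost + e₂.cost + 1
  | div e₁ e₂ => e₁.cost + e₂.cost + 1

def Test.eval (m : Mem) : Test → Prop
  | intEq e₁ e₂ => e₁.eval m = e₂.eval m
  | intLt e₁ e₂ => e₁.eval m < e₂.eval m
  | realEq e₁ e₂ => e₁.eval m = e₂.eval m
  | realLt e₁ e₂ => e₁.eval m < e₂.eval m
  | not b => ¬ b.eval m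
  | and b₁ b₂ => b₁.eval m ∧ b₂.eval m

/-- The number of operations in a test. -/
def Test.cost : Test → ℕ
  | intEq e₁ e₂ => e₁.cost + e₂.cost + 1
  | intLt e₁ e₂ => e₁.cost + e₂.cost + 1
  | realEq e₁ e₂ => e₁.cost + e₂.cost + 1
  | realLt e₁ e₂ => e₁.cost + e₂.cost + 1
  | not b => b.cost + 1
  | and b₁ b₂ => b₁.cost + b₂.cost + 1

/-- `Exec p m m' T`: the program `p`, started with the memory `m`, halts after exactly `T` steps
with the memory `m'`. -/
inductive Exec : Program → Mem → Mem → ℕ → Prop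
  | skip (m : Mem) : Exec .skip m m 1
  | setInt (x : ℕ) (e : IntExp) (m : Mem) :
      Exec (.setInt x e) m
        { m with intReg := Function.update m.intReg x (e.eval m) } (e.cost + 1)
  | setReal (x : ℕ) (e : RealExp) (m : Mem) :
      Exec (.setReal x e) m
        { m with realReg := Function.update m.realReg x (e.eval m) } (e.cost + 1)
  | storeInt (a : ℕ) (i e : IntExp) (m : Mem) :
      Exec (.storeInt a i e) m
        { m with
          intArr := Function.update m.intArr a
            (Function.update (m.intArr a) (i.eval m) (e.eval m)) } (i.cost + e.cost + 1)
  | storeReal (a : ℕ) (i : IntExp) (e : RealExp) (m : Mem) :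
      Exec (.storeReal a i e) m
        { m with
          realArr := Function.update m.realArr a
            (Function.update (m.realArr a) (i.eval m) (e.eval m)) } (i.cost + e.cost + 1)
  | seq (p q : Program) (m m' m'' : Mem) (T T' : ℕ) :
      Exec p m m' T → Exec q m' m'' T' → Exec (.seq p q) m m'' (T + T')
  | iteTrue (b : Test) (p q : Program) (m m' : Mem) (T : ℕ) :
      b.eval m → Exec p m m' T → Exec (.ite b p q) m m' (b.cost + T)
  | iteFalse (b : Test) (p q : Program) (m m' : Mem) (T : ℕ) :
      ¬ b.eval m → Exec q m m' T → Exec (.ite b p q) m m' (b.cost + T)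
  | whileTrue (b : Test) (p : Program) (m m' m'' : Mem) (T T' : ℕ) :
      b.eval m → Exec p m m' T → Exec (.while b p) m' m'' T' →
        Exec (.while b p) m m'' (b.cost + T + T')
  | whileFalse (b : Test) (p : Program) (m : Mem) :
      ¬ b.eval m → Exec (.while b p) m m b.cost

/-- A vector of length `n` as the content of an array. -/
def ofVec {α : Type} [Zero α] {n : ℕ} (v : Fin n → α) : ℕ → α :=
  fun x => if h : x < n then v ⟨x, h⟩ else 0

open Classical in
/-- The input: the integer registers `0` and `1` hold `n` and `k`, the integer arrays `0` and `1`
hold the adjacency matrix of the communication graph (row by row) and the directions (`1` for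
counterclockwise, `0` for clockwise), the real register `0` holds the communication range, and the
real arrays `0`, `1`, `2`, `3` hold the Cartesian coordinates of the centres and, relative to the
centres, of the starting positions. Everything else is `0`. -/
noncomputable def input {n : ℕ} (S : SCS n) (k : ℕ) : Mem where
  intReg := fun x => if x = 0 then n else if x = 1 then k else 0
  intArr := fun a =>
    if a = 0 then fun x => if ∃ i j : Fin n, S.G.Adj i j ∧ x = i * n + j then 1 else 0
    else if a = 1 then ofVec fun i => if S.g i = 1 then 1 else 0
    else fun _ => 0
  realReg := fun x => if x = 0 then S.ε else 0
  realArr := fun a =>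
    if a = 0 then ofVec fun i => (S.center i).re
    else if a = 1 then ofVec fun i => (S.center i).im
    else if a = 2 then ofVec fun i => Real.cos (S.f i)
    else if a = 3 then ofVec fun i => Real.sin (S.f i)
    else fun _ => 0

/-- The output in `ℕ ∪ {∞}`: infinity if the integer register `2` holds `0`, and the content of the
integer register `3` otherwise. -/
def output (m : Mem) : ℕ∞ :=
  if m.intReg 2 = 0 then ⊤ else (m.intReg 3 : ℕ∞)

open Classical in
/-- The integer array `2` holds the adjacency matrix of the graph `H`, row by row. -/
def HoldsGraph {n : ℕ} (m : Mem) (H : SimpleGraph (Fin n)) : Prop :=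
  ∀ i j : Fin n, m.intArr 2 (i * n + j) = if H.Adj i j then 1 else 0

end RealRAM

/-! Starvation does not depend on the details of the shifting protocol. When two surviving robots
face each other at a link, both stay; had both crossed, the same two trajectories would be occupied.
So the set of trajectories occupied by survivors evolves as if every survivor followed its ring
(`loc_image`), although the identities are permuted. A survivor that starves follows its ring, and
it meets someone exactly when some survivor's ring reaches the other end of the link at the same
time. Hence `u` starves if and only if no neighbour of `u` in the meeting graph survives
(`starves_iff`). To starve a set of `k` survivors, the set must be independent in the meeting graph
and all its neighbours must leave, and removing just these suffices. The resilience is therefore the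
least number of neighbours of an independent `k`-tuple of distinct robots (`resilience_eq`).

For the meeting graph, note that the schedule has period 1 and reaches each link exactly once per
period. Disjointness of the circles and the bound on the communication range bound the degrees by an
absolute constant, so there are `O(n)` links, and one period can be simulated in `O(n)` rounds of
`O(n)` steps each. The machine cannot compute the times of the links, but it only needs their order;
a rational function of the coordinates that increases strictly with time replaces them
(`timeKey_strictMonoOn`, `Meets.linkKey_eq`).

Later periods need no further simulation. Let `σ` be the inverse of the permutation that moves each
robot along its ring for one period. If `u` and `v` meet at time `t`, then `σ u` and `σ v` meet at
time `t + 1`, so the meeting graph is the closure under `σ` of the meetings in the first period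
(`mem_of_meetingGraph_adj`). Orbits of pairs are marked until a marked pair is reached; every step
but the last of each orbit marks a new pair, so all this takes `O(n ^ 2)` steps (`exec_markOrbit`).

The second phase runs through the `n ^ k` tuples as the numbers with `k` digits in base `n`, and
evaluates each in `O(k * n)` steps. Correctness and time are proved together by Hoare-style rules
for `Runs`. -/

namespace SCS

/-! ### Geometry of the link positions -/

variable {n : ℕ} (S : SCS n)

/-- Unit circles whose centres are at distance at most 2 always intersect, on the perpendicular
bisector of the centres. -/
theorem two_lt_dist {i j : Fin n} (h : i ≠ j) : 2 < dist (S.center i) (S.center j) := by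
  by_contra! hle
  have hd := S.disjoint i j h
  set a := S.center i with ha
  set b := S.center j with hb
  by_cases hab : a = b
  · rw [hab] at hd
    have : b + 1 ∈ Metric.sphere b 1 := by simp
    exact Set.disjoint_left.1 hd this this
  set d := dist a b with hdd
  have hdpos : 0 < d := dist_pos.2 hab
  -- In the coordinate `z` of the point `a + (b - a) * z`, the centres are 0 and 1 and the radius is
  -- `1 / d`; the circles meet at `z = 1 / 2 + r * I`.
  set r := Real.sqrt (1 / d ^ 2 - 1 / 4) with hr
  have hr2 : r * r = 1 / d ^ 2 - 1 / 4 := by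
    apply Real.mul_self_sqrt
    rw [sub_nonneg, div_le_div_iff₀ (by norm_num) (by positivity)]
    nlinarith
  have key : ∀ z : ℂ, z.re = 1 / 2 ∨ z.re = - (1 / 2) → z.im = r → ‖(b - a) * z‖ = 1 := by
    intro z h1 h2
    have h3 : ‖z‖ ^ 2 = 1 / d ^ 2 := by
      rw [Complex.sq_norm, Complex.normSq_apply, h2, hr2]
      rcases h1 with h1 | h1 <;> rw [h1] <;> ring
    have h4 : ‖b - a‖ = d := by rw [hdd, dist_comm, dist_eq_norm]
    have h5 : (‖(b - a) * z‖) ^ 2 = 1 := by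
      rw [norm_mul, mul_pow, h3, h4]; field_simp
    exact (pow_eq_one_iff_of_nonneg (norm_nonneg _) two_ne_zero).1 h5
  have m1 : a + (b - a) * ⟨1 / 2, r⟩ ∈ Metric.sphere a 1 := by
    rw [mem_sphere_iff_norm, add_sub_cancel_left]
    exact key _ (Or.inl rfl) rfl
  have m2 : a + (b - a) * ⟨1 / 2, r⟩ ∈ Metric.sphere b 1 := by
    rw [mem_sphere_iff_norm]
    have : a + (b - a) * ⟨1 / 2, r⟩ - b = (b - a) * ⟨-(1 / 2), r⟩ := by
      have : (⟨1 / 2, r⟩ : ℂ) = ⟨-(1 / 2), r⟩ + 1 := by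
        apply Complex.ext <;> simp; norm_num
      rw [this]; ring
    rw [this]
    exact key _ (Or.inr rfl) rfl
  exact Set.disjoint_left.1 hd m1 m2

theorem center_ne {i j : Fin n} (h : i ≠ j) : S.center i ≠ S.center j := by
  intro he
  have := S.two_lt_dist h
  rw [he, dist_self] at this
  linarith

theorem position_mem (i : Fin n) (t : ℝ) : S.position i t ∈ Metric.sphere (S.center i) 1 :=
  circleMap_mem_sphere _ zero_le_one _

theorem link_mem {i j : Fin n} (h : i ≠ j) : S.link i j ∈ Metric.sphere (S.center i) 1 := by
  have : S.center j - S.center i ≠ 0 := sub_ne_zero.2 (S.center_ne h.symm)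
  rw [mem_sphere_iff_norm, link, add_sub_cancel_left, norm_div]
  simp [this]

theorem eq_of_position_eq_link {i j k : Fin n} (h : j ≠ k) {t : ℝ}
    (hp : S.position i t = S.link j k) : i = j := by
  by_contra hij
  exact Set.disjoint_left.1 (S.disjoint i j hij) (S.position_mem i t) (hp ▸ S.link_mem h)

/-- Equal links mean that both neighbours lie in the same direction from `C_i`, at distances between
2 and `2 + ε`. Their centres would then be less than 2 apart. -/
theorem link_injective {i j k : Fin n} (hj : S.G.Adj i j) (hk : S.G.Adj i k)
    (h : S.link i j = S.link i k) : j = k := by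
  by_contra hjk
  have e1 := S.dist_le i j hj
  have e2 := S.dist_le i k hk
  have l1 := S.two_lt_dist hj.ne
  have l2 := S.two_lt_dist hk.ne
  have l3 := S.two_lt_dist hjk
  have hε := S.ε_lt
  rw [dist_comm, dist_eq_norm] at e1 e2 l1 l2
  unfold link at h
  have h' := add_left_cancel h
  set x := S.center j - S.center i with hx
  set y := S.center k - S.center i with hy
  have hx0 : (‖x‖ : ℂ) ≠ 0 := by
    norm_cast; linarith
  have hy0 : (‖y‖ : ℂ) ≠ 0 := by
    norm_cast; linarith
  have : S.center j - S.center k = x - y := by rw [hx, hy]; ring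
  rw [dist_eq_norm, this] at l3
  have h2 : x - y = ((‖x‖ - ‖y‖ : ℝ) : ℂ) * (y / ‖y‖) := by
    push_cast
    rw [sub_mul, ← h', mul_div_cancel₀ _ hx0, h', mul_div_cancel₀ _ hy0]
  have h3 : ‖y / (‖y‖ : ℂ)‖ = 1 := by
    have : ‖y‖ ≠ 0 := by linarith
    simp [this]
  rw [h2, norm_mul, h3, mul_one, Complex.norm_real, Real.norm_eq_abs] at l3
  rcases abs_cases (‖x‖ - ‖y‖) with h | h <;> linarith

/-- At time `t`, the scheduled positions in `C_i` and `C_j` are the two ends of a link. -/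
def Meets (t : ℝ) (i j : Fin n) : Prop := S.G.Adj i j ∧ S.position i t = S.link i j

/-! ### Crossing and shifting at a single time -/

variable {S}

theorem Meets.symm {t : ℝ} {i j : Fin n} (h : S.Meets t i j) : S.Meets t j i :=
  ⟨h.1.symm, (S.sync i j h.1 t).1 h.2⟩

theorem Meets.unique {t : ℝ} {i j k : Fin n} (h : S.Meets t i j) (h' : S.Meets t i k) : j = k :=
  S.link_injective h.1 h'.1 (h.2.symm.trans h'.2)

theorem Meets.cross_eq {t : ℝ} {i j : Fin n} (h : S.Meets t i j) : S.cross i t = j := by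
  have hex : ∃ j, S.G.Adj i j ∧ S.position i t = S.link i j := ⟨j, h⟩
  rw [cross, dif_pos hex]
  exact Meets.unique hex.choose_spec h

theorem cross_eq_self {t : ℝ} {i : Fin n} (h : ∀ j, ¬ S.Meets t i j) : S.cross i t = i :=
  dif_neg fun ⟨j, hj⟩ => h j hj

theorem cross_cross (t : ℝ) (i : Fin n) : S.cross (S.cross i t) t = i := by
  by_cases h : ∃ j, S.Meets t i j
  · obtain ⟨j, hj⟩ := h
    rw [hj.cross_eq, hj.symm.cross_eq]
  · push Not at h
    rw [cross_eq_self h, cross_eq_self h]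

theorem cross_injective (t : ℝ) : Function.Injective fun i => S.cross i t := fun i j h => by
  have := congrArg (fun x => S.cross x t) h
  simpa [cross_cross] using this

theorem Meets.shift_eq {R : Finset (Fin n)} {loc : Fin n → Fin n} {t : ℝ} {u j : Fin n}
    (h : S.Meets t (loc u) j) (hv : ∀ v, v ∉ R → loc v ≠ j) : S.shift R loc t u = j := by
  have hex : ∃ j, S.G.Adj (loc u) j ∧ S.position (loc u) t = S.link (loc u) j ∧
      ∀ v, v ∉ R → S.position (loc v) t ≠ S.link j (loc u) :=
    ⟨j, h.1, h.2, fun v hvR hp => hv v hvR (S.eq_of_position_eq_link h.1.ne' hp)⟩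
  rw [shift, dif_pos hex]
  exact Meets.unique ⟨hex.choose_spec.1, hex.choose_spec.2.1⟩ h

theorem Meets.shift_eq_self {R : Finset (Fin n)} {loc : Fin n → Fin n} {t : ℝ} {u v : Fin n}
    (h : S.Meets t (loc u) (loc v)) (hv : v ∉ R) : S.shift R loc t u = loc u := by
  refine dif_neg ?_
  rintro ⟨j, h1, h2, h3⟩
  have : loc v = j := h.unique ⟨h1, h2⟩
  exact h3 v hv (this ▸ h.symm.2)

theorem shift_eq_self {R : Finset (Fin n)} {loc : Fin n → Fin n} {t : ℝ} {u : Fin n}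
    (h : ∀ j, ¬ S.Meets t (loc u) j) : S.shift R loc t u = loc u :=
  dif_neg fun ⟨j, h1, h2, _⟩ => h j ⟨h1, h2⟩

/-- Under the shifting protocol, a robot shifts to the next trajectory of the ring exactly when
no surviving robot is there. -/
theorem shift_cases (R : Finset (Fin n)) (loc : Fin n → Fin n) (t : ℝ) (u : Fin n) :
    S.shift R loc t u = S.cross (loc u) t ∧ (∀ v, v ∉ R → loc v = S.cross (loc u) t →
      loc v = loc u) ∨
    S.shift R loc t u = loc u ∧ ∃ v, v ∉ R ∧ loc v = S.cross (loc u) t ∧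
      S.Meets t (loc u) (loc v) := by
  by_cases h : ∃ j, S.Meets t (loc u) j
  · obtain ⟨j, hj⟩ := h
    by_cases hv : ∃ v, v ∉ R ∧ loc v = j
    · obtain ⟨v, hv, rfl⟩ := hv
      exact Or.inr ⟨hj.shift_eq_self hv, v, hv, hj.cross_eq.symm, hj⟩
    · push Not at hv
      rw [hj.cross_eq, hj.shift_eq hv]
      exact Or.inl ⟨rfl, fun v hvR hj' => absurd hj' (hv v hvR)⟩
  · push Not at h
    rw [cross_eq_self h, shift_eq_self h]
    exact Or.inl ⟨rfl, fun v _ hv => hv⟩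

/-- If two survivors face each other, both stay, but exchanging their names turns this into a double
crossing. Otherwise a survivor at a link crosses anyway. As `cross` is an involution, the occupied
sets agree. -/
theorem shift_image (R : Finset (Fin n)) (loc : Fin n → Fin n) (t : ℝ) :
    S.shift R loc t '' {u | u ∉ R} = (fun i => S.cross i t) '' (loc '' {u | u ∉ R}) := by
  ext i
  constructor
  · rintro ⟨u, hu, rfl⟩
    rcases shift_cases (S := S) R loc t u with ⟨h1, -⟩ | ⟨h1, w, hw, h1', -⟩
    · exact ⟨_, ⟨u, hu, rfl⟩, h1.symm⟩
    · refine ⟨_, ⟨w, hw, rfl⟩, ?_⟩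
      simp only [h1, h1', cross_cross]
  · rintro ⟨_, ⟨u, hu, rfl⟩, rfl⟩
    rcases shift_cases (S := S) R loc t u with ⟨h1, -⟩ | ⟨h1, w, hw, h1', h2⟩
    · exact ⟨u, hu, h1⟩
    · exact ⟨w, hw, by simp only [h2.symm.shift_eq_self hu, h1']⟩

theorem foldl_shift_image (R : Finset (Fin n)) (l : List ℝ) (loc : Fin n → Fin n) :
    l.foldl (S.shift R) loc '' {u | u ∉ R} =
      (fun i => l.foldl S.cross i) '' (loc '' {u | u ∉ R}) := by
  induction l generalizing loc with
  | nil => simp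
  | cons t l ih =>
    rw [List.foldl_cons, ih, shift_image, Set.image_image]
    rfl

/-! ### Whole histories, and the characterization of starvation -/

variable (S)

theorem loc_image (R : Finset (Fin n)) (t : ℝ) :
    S.loc R t '' {u | u ∉ R} = (fun u => S.ring u t) '' {u | u ∉ R} := by
  have := foldl_shift_image (S := S) R (S.events t) id
  rwa [Set.image_id] at this

/-- Some link position is reached at time `t`. -/
def IsEvent (t : ℝ) : Prop := ∃ i j, S.Meets t i j

theorem mem_events {s t : ℝ} : s ∈ S.events t ↔ 0 ≤ s ∧ s < t ∧ S.IsEvent s := by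
  rw [events, Finset.mem_sort, Set.Finite.mem_toFinset, eventSet, ← and_assoc]
  rfl

theorem events_pairwise (t : ℝ) : (S.events t).Pairwise (· < ·) :=
  (Finset.sortedLT_sort _).pairwise

variable {S}

theorem events_eq {t : ℝ} {l : List ℝ} (hl : l.Pairwise (· < ·))
    (h : ∀ s, s ∈ l ↔ 0 ≤ s ∧ s < t ∧ S.IsEvent s) : S.events t = l := by
  refine List.Perm.eq_of_pairwise' (r := (· < ·)) (S.events_pairwise t) hl ?_
  rw [List.perm_ext_iff_of_nodup]
  · intro a
    rw [mem_events, h]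
  · exact (S.events_pairwise t).imp fun h => h.ne
  · exact hl.imp fun h => h.ne

/-- A strictly increasing list is determined by its members, so a history can be cut at any time
`s`; the composition laws for `ring` and `loc` rest on this. -/
theorem events_eq_append {s t : ℝ} {l : List ℝ} (h0 : 0 ≤ s) (hst : s ≤ t)
    (hl : l.Pairwise (· < ·)) (h : ∀ r, r ∈ l ↔ s ≤ r ∧ r < t ∧ S.IsEvent r) :
    S.events t = S.events s ++ l := by
  apply events_eq
  · refine List.pairwise_append.2 ⟨S.events_pairwise s, hl, fun a ha b hb => ?_⟩
    exact ((S.mem_events).1 ha).2.1.trans_le ((h b).1 hb).1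
  · intro r
    rw [List.mem_append, mem_events, h]
    constructor
    · rintro (⟨h1, h2, h3⟩ | ⟨h1, h2, h3⟩)
      · exact ⟨h1, h2.trans_le hst, h3⟩
      · exact ⟨h0.trans h1, h2, h3⟩
    · rintro ⟨h1, h2, h3⟩
      rcases lt_or_ge r s with h4 | h4
      · exact Or.inl ⟨h1, h4, h3⟩
      · exact Or.inr ⟨h4, h2, h3⟩

theorem events_eq_append_last {t : ℝ} (h : S.events t ≠ []) :
    ∃ s, 0 ≤ s ∧ s < t ∧ S.IsEvent s ∧ S.events t = S.events s ++ [s] := by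
  have hs := List.getLast_mem h
  set s := (S.events t).getLast h with hsd
  obtain ⟨h0, hst, he⟩ := S.mem_events.1 hs
  refine ⟨s, h0, hst, he, events_eq_append h0 hst.le (List.pairwise_singleton _ _) ?_⟩
  intro r
  rw [List.mem_singleton]
  refine ⟨fun hr => by rw [hr]; exact ⟨le_rfl, hst, he⟩, fun ⟨h1, h2, h3⟩ => ?_⟩
  have hr : r ∈ S.events t := S.mem_events.2 ⟨h0.trans h1, h2, h3⟩
  have := ((S.events_pairwise t).imp le_of_lt).rel_getLast hr
  exact le_antisymm this h1

theorem ring_eq_of_append {s t : ℝ} {l : List ℝ} (h : S.events t = S.events s ++ l) (u : Fin n) :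
    S.ring u t = l.foldl S.cross (S.ring u s) := by
  rw [ring, h, List.foldl_append]; rfl

theorem loc_eq_of_append {s t : ℝ} {l : List ℝ} (h : S.events t = S.events s ++ l)
    (R : Finset (Fin n)) : S.loc R t = l.foldl (S.shift R) (S.loc R s) := by
  rw [loc, h, List.foldl_append]; rfl

/-- If the surviving robot `u` shifts at every link up to time `t`, then it follows its ring. -/
theorem loc_eq_ring {R : Finset (Fin n)} {u : Fin n}
    (h : ∀ s, 0 ≤ s → S.loc R s u = S.ring u s → ∀ j, S.Meets s (S.ring u s) j →
      ∀ v, v ∉ R → S.loc R s v ≠ j) (t : ℝ) : S.loc R t u = S.ring u t := by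
  induction hN : (S.events t).length generalizing t with
  | zero =>
    have : S.events t = [] := List.length_eq_zero_iff.1 hN
    simp [loc, ring, this]
  | succ N ih =>
    obtain ⟨s, h0, hst, he, hap⟩ := events_eq_append_last (S := S) (t := t) (by
      intro h; simp [h] at hN)
    -- The hypothesis about the link at time `s` applies only if `u` is still on its ring there,
    -- which is what the induction on the number of events supplies.
    have hs := ih s (by rw [hap] at hN; simpa using hN)
    rw [loc_eq_of_append hap, ring_eq_of_append hap]
    change S.shift R (S.loc R s) s u = S.cross (S.ring u s) s
    by_cases hj : ∃ j, S.Meets s (S.ring u s) j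
    · obtain ⟨j, hj⟩ := hj
      rw [hj.cross_eq]
      exact Meets.shift_eq (hs ▸ hj) (h s h0 hs j hj)
    · push Not at hj
      rw [cross_eq_self hj, shift_eq_self (hs ▸ hj), hs]

/-- A meeting partner `v` on its ring need not itself be at the link under the protocol, but by
`loc_image` some survivor is. Conversely, a survivor found opposite `u` stands where the ring of
some survivor leads, and that one is a neighbour of `u`. -/
theorem starves_iff {R : Finset (Fin n)} {u : Fin n} :
    S.Starves R u ↔ ∀ v, v ∉ R → ¬ S.meetingGraph.Adj u v := by
  have hstv : S.Starves R u ↔ ∀ t, 0 ≤ t → ∀ j, S.Meets t (S.loc R t u) j →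
      ∀ v, v ∉ R → S.loc R t v ≠ j := by
    constructor
    · intro h t ht j hj v hv hvj
      exact h t ht j hj.1 hj.2 v hv (hvj ▸ hj.symm.2)
    · intro h t ht j h1 h2 v hv hp
      exact h t ht j ⟨h1, h2⟩ v hv (S.eq_of_position_eq_link h1.ne' hp)
  rw [hstv]
  constructor
  · rintro h v hv ⟨t, ht, hm⟩
    have hloc := loc_eq_ring (S := S) (R := R) (u := u)
      (fun s hs he j hj => h s hs j (he ▸ hj)) t
    have : S.ring v t ∈ S.loc R t '' {u | u ∉ R} := by
      rw [loc_image]; exact ⟨v, hv, rfl⟩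
    obtain ⟨w, hw, hwv⟩ := this
    exact h t ht _ (hloc ▸ hm) w hw hwv
  · intro h
    have key : ∀ t, 0 ≤ t → ∀ j, S.Meets t (S.ring u t) j → ∀ v, v ∉ R → S.loc R t v ≠ j := by
      rintro t ht j hj v hv rfl
      have : S.loc R t v ∈ (fun u => S.ring u t) '' {u | u ∉ R} := by
        rw [← loc_image]; exact ⟨v, hv, rfl⟩
      obtain ⟨w, hw, hwv⟩ := this
      have hwv' : S.ring w t = S.loc R t v := hwv
      exact h w hw ⟨t, ht, by rw [hwv']; exact hj⟩
    intro t ht j hj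
    rw [loc_eq_ring (fun s hs _ => key s hs) t] at hj
    exact key t ht j hj

end SCS

/-! ### Resilience as a minimum over independent tuples -/

open Classical in
/-- The number of neighbours of the vertices of the tuple `d` if these are distinct and pairwise
nonadjacent, and infinity otherwise. -/
noncomputable def SimpleGraph.tupleCost {n k : ℕ} (M : SimpleGraph (Fin n)) (d : Fin k → Fin n) :
    ℕ∞ :=
  if Function.Injective d ∧ ∀ a b, ¬ M.Adj (d a) (d b) then
    ((Finset.univ.filter fun v => ∃ a, M.Adj (d a) v).card : ℕ∞) else ⊤

namespace SCS

variable {n : ℕ} (S : SCS n)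

theorem mem_starving {R : Finset (Fin n)} {u : Fin n} :
    u ∈ S.starving R ↔ u ∉ R ∧ ∀ v, v ∉ R → ¬ S.meetingGraph.Adj u v := by
  simp [starving, starves_iff]

theorem resilience_eq (k : ℕ) :
    S.resilience k = ⨅ d : Fin k → Fin n, S.meetingGraph.tupleCost d := by
  classical
  apply le_antisymm
  · refine le_iInf fun d => ?_
    unfold SimpleGraph.tupleCost
    split_ifs with hd
    · obtain ⟨hinj, hind⟩ := hd
      -- The cheapest choice removes exactly the neighbours of the tuple; independence keeps the
      -- tuple itself among the survivors.
      refine iInf₂_le_of_le (Finset.univ.filter fun v => ∃ a, S.meetingGraph.Adj (d a) v) ?_ le_rfl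
      have : Finset.univ.image d ⊆
          S.starving (Finset.univ.filter fun v => ∃ a, S.meetingGraph.Adj (d a) v) := by
        intro u hu
        obtain ⟨a, -, rfl⟩ := Finset.mem_image.1 hu
        rw [mem_starving]
        refine ⟨by simpa using fun b => hind b a, fun v hv hav => hv ?_⟩
        simpa using ⟨a, hav⟩
      simpa [Finset.card_image_of_injective _ hinj] using Finset.card_le_card this
    · exact le_top
  · refine le_iInf₂ fun R hR => ?_
    -- Any `k` starving survivors form an independent set, because a survivor cannot be a neighbour
    -- of a starving one, and all their neighbours lie in `R`.
    obtain ⟨U, hU, hUk⟩ := Finset.exists_subset_card_eq hR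
    let e := U.equivFinOfCardEq hUk
    refine (iInf_le _ fun a => (e.symm a : Fin n)).trans ?_
    have hm : ∀ a, (e.symm a : Fin n) ∉ R ∧
        ∀ v, v ∉ R → ¬ S.meetingGraph.Adj (e.symm a : Fin n) v :=
      fun a => S.mem_starving.1 (hU (e.symm a).2)
    unfold SimpleGraph.tupleCost
    rw [if_pos ⟨Subtype.val_injective.comp e.symm.injective,
      fun a b => (hm a).2 _ (hm b).1⟩]
    refine Nat.cast_le.2 (Finset.card_le_card fun v hv => ?_)
    obtain ⟨-, a, ha⟩ := Finset.mem_filter.1 hv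
    by_contra hvR
    exact (hm a).2 v hvR ha

end SCS

/-! ### Periodicity of the schedule and bounded degree -/

namespace SCS

variable {n : ℕ} {S : SCS n}

theorem position_add_one (i : Fin n) (t : ℝ) : S.position i (t + 1) = S.position i t := by
  unfold position
  rw [circleMap_eq_circleMap_iff _ one_ne_zero]
  refine ⟨S.g i, ?_⟩
  push_cast
  ring

theorem meets_add_one {t : ℝ} {i j : Fin n} : S.Meets (t + 1) i j ↔ S.Meets t i j := by
  rw [Meets, Meets, position_add_one]

theorem isEvent_add_one {t : ℝ} : S.IsEvent (t + 1) ↔ S.IsEvent t := by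
  simp only [IsEvent, meets_add_one]

theorem cross_add_one (i : Fin n) (t : ℝ) : S.cross i (t + 1) = S.cross i t := by
  by_cases h : ∃ j, S.Meets t i j
  · obtain ⟨j, hj⟩ := h
    rw [hj.cross_eq, (meets_add_one.2 hj).cross_eq]
  · push Not at h
    rw [cross_eq_self h, cross_eq_self fun j hj => h j (meets_add_one.1 hj)]

theorem events_add_one {t : ℝ} (ht : 0 ≤ t) :
    S.events (t + 1) = S.events 1 ++ (S.events t).map (· + 1) := by
  refine events_eq_append zero_le_one (by linarith) ?_ ?_
  · rw [List.pairwise_map]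
    exact (S.events_pairwise t).imp fun h => by linarith
  · intro r
    simp only [List.mem_map, mem_events]
    constructor
    · rintro ⟨s, ⟨h1, h2, h3⟩, rfl⟩
      exact ⟨by linarith, by linarith, isEvent_add_one.2 h3⟩
    · rintro ⟨h1, h2, h3⟩
      refine ⟨r - 1, ⟨by linarith, by linarith, ?_⟩, by ring⟩
      rw [← isEvent_add_one]
      simpa using h3

/-- After one period the schedule repeats, so the rest of the path is that of the robot which starts
in the trajectory reached at time 1. -/
theorem ring_add_one (u : Fin n) {t : ℝ} (ht : 0 ≤ t) :
    S.ring u (t + 1) = S.ring (S.ring u 1) t := by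
  rw [ring_eq_of_append (events_add_one ht), List.foldl_map]
  simp only [cross_add_one]
  rfl

theorem ring_injective (t : ℝ) : Function.Injective fun u => S.ring u t := by
  have : ∀ l : List ℝ, Function.Injective fun u => l.foldl S.cross u := by
    intro l
    induction l with
    | nil => exact fun _ _ h => h
    | cons t l ih => exact ih.comp (cross_injective t)
  exact this _

theorem ring_zero (u : Fin n) : S.ring u 0 = u := by
  have : S.events 0 = [] := events_eq List.Pairwise.nil fun s => by
    simp only [List.not_mem_nil, false_iff]
    rintro ⟨h1, h2, -⟩
    linarith
  rw [ring, this]; rfl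

theorem ring_eq_of_no_event {s t : ℝ} (h0 : 0 ≤ s) (hst : s ≤ t)
    (h : ∀ r, s ≤ r → r < t → ¬ S.IsEvent r) (u : Fin n) : S.ring u t = S.ring u s := by
  have := events_eq_append (S := S) (l := []) h0 hst List.Pairwise.nil fun r => by
    simp only [List.not_mem_nil, false_iff]
    exact fun ⟨h1, h2, h3⟩ => h r h1 h2 h3
  rw [ring_eq_of_append this]; rfl

theorem ring_eq_cross {s t : ℝ} (h0 : 0 ≤ s) (hst : s < t) (hs : S.IsEvent s)
    (h : ∀ r, s < r → r < t → ¬ S.IsEvent r) (u : Fin n) :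
    S.ring u t = S.cross (S.ring u s) s := by
  have := events_eq_append (S := S) (l := [s]) h0 hst.le (List.pairwise_singleton _ _) fun r => by
    rw [List.mem_singleton]
    refine ⟨fun hr => by rw [hr]; exact ⟨le_rfl, hst, hs⟩, fun ⟨h1, h2, h3⟩ => ?_⟩
    by_contra hne
    exact h r (lt_of_le_of_ne h1 (Ne.symm hne)) h2 h3
  rw [ring_eq_of_append this]; rfl

/-- The crossing at time `s` affects `ring` only at times strictly after `s`. This provides a later
time before which nothing else happens; the cap at 1 keeps it within the period. -/
theorem exists_next_event {s : ℝ} (h1 : s < 1) :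
    ∃ t, s < t ∧ t ≤ 1 ∧ ∀ r, 0 ≤ r → s < r → r < t → ¬ S.IsEvent r := by
  classical
  let A : Finset ℝ := insert 1 ((S.finite_eventSet 1).toFinset.filter (s < ·))
  have hA : A.Nonempty := Finset.insert_nonempty _ _
  refine ⟨A.min' hA, ?_, A.min'_le 1 (Finset.mem_insert_self _ _), fun r h0 hr hrt he => ?_⟩
  · rw [Finset.lt_min'_iff]
    intro y hy
    rcases Finset.mem_insert.1 hy with rfl | hy
    · exact h1
    · exact (Finset.mem_filter.1 hy).2
  · have h1 : r < 1 := hrt.trans_le (A.min'_le 1 (Finset.mem_insert_self _ _))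
    refine absurd (A.min'_le r (Finset.mem_insert_of_mem ?_)) (not_le.2 hrt)
    rw [Finset.mem_filter, Set.Finite.mem_toFinset]
    exact ⟨⟨⟨h0, h1⟩, he⟩, hr⟩

/-- Trajectories linked to the same trajectory lie in different cells of a unit grid. -/
theorem card_neighbors_le (i : Fin n) (A : Finset (Fin n)) (hA : ∀ j ∈ A, S.G.Adj i j) :
    A.card ≤ 36 := by
  classical
  let q : Fin n → ℤ × ℤ := fun j =>
    (⌊(S.center j - S.center i).re⌋, ⌊(S.center j - S.center i).im⌋)
  have hmaps : ∀ j ∈ A, q j ∈ Finset.Icc (-3 : ℤ) 2 ×ˢ Finset.Icc (-3 : ℤ) 2 := by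
    intro j hj
    have h1 := S.dist_le i j (hA j hj)
    have h2 := S.ε_lt
    rw [dist_comm, dist_eq_norm] at h1
    have key : ∀ x : ℝ, |x| ≤ ‖S.center j - S.center i‖ → ⌊x⌋ ∈ Finset.Icc (-3 : ℤ) 2 := by
      intro x hx
      have hx' := abs_le.1 (hx.trans h1)
      rw [Finset.mem_Icc, Int.le_floor, ← Int.lt_add_one_iff, Int.floor_lt]
      push_cast
      constructor <;> linarith [hx'.1, hx'.2]
    exact Finset.mem_product.2
      ⟨key _ (Complex.abs_re_le_norm _), key _ (Complex.abs_im_le_norm _)⟩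
  have hinj : Set.InjOn q A := by
    intro j _ k _ hjk
    by_contra hne
    have h1 := S.two_lt_dist hne
    have e1 := congrArg Prod.fst hjk
    have e2 := congrArg Prod.snd hjk
    have r1 := Int.abs_sub_lt_one_of_floor_eq_floor e1
    have r2 := Int.abs_sub_lt_one_of_floor_eq_floor e2
    have h3 := Complex.norm_le_abs_re_add_abs_im (S.center j - S.center k)
    rw [dist_eq_norm] at h1
    simp only [Complex.sub_re, Complex.sub_im, sub_sub_sub_cancel_right] at r1 r2 h3
    linarith
  have := Finset.card_le_card_of_injOn q hmaps hinj
  simpa using this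

end SCS

/-! ### Comparing times by rational arithmetic -/

/-- A strictly increasing function of the direction in `[0, 2π)` of the vector `(x, y)`, rational on
each quadrant. -/
noncomputable def directionKey (x y : ℝ) : ℝ :=
  let q := if x < 0 then 0 - x * x / (x * x + y * y) else x * x / (x * x + y * y)
  if y < 0 then 3 + q else 1 - q

/-- Scale invariance makes it unnecessary to normalize the vector between two centres, which would
need a square root. -/
theorem directionKey_mul {r : ℝ} (hr : 0 < r) (x y : ℝ) :
    directionKey (r * x) (r * y) = directionKey x y := by
  have h1 : r * x * (r * x) / (r * x * (r * x) + r * y * (r * y)) = x * x / (x * x + y * y) := by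
    rw [show r * x * (r * x) = (r * r) * (x * x) by ring,
      show (r * r) * (x * x) + r * y * (r * y) = (r * r) * (x * x + y * y) by ring,
      mul_div_mul_left _ _ (by positivity)]
  unfold directionKey
  rw [h1]
  simp only [mul_neg_iff, hr, hr.not_gt, true_and, false_and, or_false]

theorem directionKey_cos_sin (θ : ℝ) : directionKey (Real.cos θ) (Real.sin θ) =
    if Real.sin θ < 0 then 3 + Real.cos θ * |Real.cos θ| else 1 - Real.cos θ * |Real.cos θ| := by
  have h : Real.cos θ * Real.cos θ + Real.sin θ * Real.sin θ = 1 := by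
    rw [← sq, ← sq, Real.cos_sq_add_sin_sq]
  have h2 : (if Real.cos θ < 0 then 0 - Real.cos θ * Real.cos θ else Real.cos θ * Real.cos θ) =
      Real.cos θ * |Real.cos θ| := by
    split_ifs with h
    · rw [abs_of_neg h]; ring
    · rw [abs_of_nonneg (not_lt.1 h)]
  simp only [directionKey, h, div_one, h2]

/-- The square with the sign of `x` kept: it makes the cosine accessible through its square without
losing the order. -/
theorem mul_abs_strictMono : StrictMono fun x : ℝ => x * |x| := by
  intro x y hxy
  simp only
  rcases abs_cases x with ⟨h1, h2⟩ | ⟨h1, h2⟩ <;> rcases abs_cases y with ⟨h3, h4⟩ | ⟨h3, h4⟩ <;>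
    rw [h1, h3] <;> nlinarith

theorem mul_abs_mem {x : ℝ} (h : |x| ≤ 1) : x * |x| ∈ Set.Icc (-1 : ℝ) 1 := by
  have := abs_le.1 h
  constructor <;> cases abs_cases x <;> nlinarith

/-- The key of the direction with angle `2πt`. -/
noncomputable def timeKey (t : ℝ) : ℝ :=
  directionKey (Real.cos (2 * Real.pi * t)) (Real.sin (2 * Real.pi * t))

theorem timeKey_of_le {t : ℝ} (h0 : 0 ≤ t) (h1 : t ≤ 1 / 2) : timeKey t =
    1 - Real.cos (2 * Real.pi * t) * |Real.cos (2 * Real.pi * t)| := by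
  have hpi := Real.pi_pos
  rw [timeKey, directionKey_cos_sin, if_neg]
  exact not_lt.2 (Real.sin_nonneg_of_nonneg_of_le_pi (by positivity) (by nlinarith))

theorem timeKey_of_lt {t : ℝ} (h0 : 1 / 2 < t) (h1 : t < 1) : timeKey t =
    3 + Real.cos (2 * Real.pi * t) * |Real.cos (2 * Real.pi * t)| := by
  have hpi := Real.pi_pos
  rw [timeKey, directionKey_cos_sin, if_pos]
  have h2 : 0 < Real.sin (2 * Real.pi - 2 * Real.pi * t) :=
    Real.sin_pos_of_pos_of_lt_pi (by nlinarith) (by nlinarith)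
  rw [Real.sin_two_pi_sub] at h2
  linarith

theorem timeKey_mem {t : ℝ} (h0 : 0 ≤ t) (h1 : t < 1) : timeKey t ∈ Set.Icc (0 : ℝ) 4 := by
  have h := mul_abs_mem (Real.abs_cos_le_one (2 * Real.pi * t))
  rcases le_or_gt t (1 / 2) with h2 | h2
  · rw [timeKey_of_le h0 h2]
    constructor <;> linarith [h.1, h.2]
  · rw [timeKey_of_lt h2 h1]
    constructor <;> linarith [h.1, h.2]

theorem timeKey_strictMonoOn : StrictMonoOn timeKey (Set.Ico 0 1) := by
  have hpi := Real.pi_pos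
  intro s hs t ht hst
  rcases le_or_gt t (1 / 2) with h2 | h2
  · rw [timeKey_of_le hs.1 (hst.le.trans h2), timeKey_of_le ht.1 h2]
    have : Real.cos (2 * Real.pi * t) < Real.cos (2 * Real.pi * s) := by
      apply Real.cos_lt_cos_of_nonneg_of_le_pi
      · have := hs.1; positivity
      · nlinarith
      · nlinarith
    have := mul_abs_strictMono this
    simp only at this
    linarith
  -- In the first half of the period the key is at most 2; in the second half it exceeds 2 strictly,
  -- because the cosine is `-1` only at time `1 / 2`.
  rcases le_or_gt s (1 / 2) with h1 | h1
  · have hcos : -1 < Real.cos (2 * Real.pi * t) := by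
      rw [← Real.cos_two_pi_sub, ← Real.cos_pi]
      apply Real.cos_lt_cos_of_nonneg_of_le_pi <;> nlinarith [ht.2]
    have h3 := mul_abs_strictMono hcos
    have h4 := mul_abs_mem (Real.abs_cos_le_one (2 * Real.pi * s))
    rw [timeKey_of_le hs.1 h1, timeKey_of_lt h2 ht.2]
    norm_num at h3
    linarith [h4.1]
  · rw [timeKey_of_lt h1 hs.2, timeKey_of_lt h2 ht.2]
    have : Real.cos (2 * Real.pi * s) < Real.cos (2 * Real.pi * t) := by
      rw [← Real.cos_two_pi_sub (2 * Real.pi * s), ← Real.cos_two_pi_sub (2 * Real.pi * t)]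
      apply Real.cos_lt_cos_of_nonneg_of_le_pi <;> nlinarith [ht.2]
    have := mul_abs_strictMono this
    simp only at this
    linarith

/-! ### The keys of the links -/

namespace SCS

variable {n : ℕ} (S : SCS n)

/-- The key of the time at which the schedule reaches the link of `C_i` with `C_j`, computed from
the coordinates of the centres and the starting positions. -/
noncomputable def linkKey (i j : Fin n) : ℝ :=
  let dx := (S.center j).re - (S.center i).re
  let dy := (S.center j).im - (S.center i).im
  let y := dy * Real.cos (S.f i) - dx * Real.sin (S.f i)
  directionKey (dx * Real.cos (S.f i) + dy * Real.sin (S.f i)) (if S.g i = 1 then y else 0 - y)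

variable {S}

/-- Rotating by `-f i`, and reflecting if the motion is clockwise, turns the vector between the
centres into a positive multiple of the unit vector with angle `2πt`. -/
theorem Meets.linkKey_eq {t : ℝ} {i j : Fin n} (h : S.Meets t i j) :
    S.linkKey i j = timeKey t := by
  obtain ⟨ha, h⟩ := h
  rw [position, link, circleMap, add_right_inj, Complex.ofReal_one, one_mul] at h
  set D := S.center j - S.center i with hD
  have hD0 : 0 < ‖D‖ := norm_pos_iff.2 (sub_ne_zero.2 (S.center_ne ha.ne'))
  have hDc : (‖D‖ : ℂ) ≠ 0 := by exact_mod_cast hD0.ne'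
  set θ := S.f i + 2 * Real.pi * S.g i * t with hθ
  have hD1 : D = ‖D‖ * Complex.exp (θ * Complex.I) := by
    rw [hθ, h, mul_div_cancel₀ _ hDc]
  have hre : (S.center j).re - (S.center i).re = ‖D‖ * Real.cos θ := by
    rw [← Complex.sub_re, ← hD]
    conv_lhs => rw [hD1]
    rw [Complex.re_ofReal_mul, Complex.exp_ofReal_mul_I_re]
  have him : (S.center j).im - (S.center i).im = ‖D‖ * Real.sin θ := by
    rw [← Complex.sub_im, ← hD]
    conv_lhs => rw [hD1]
    rw [Complex.im_ofReal_mul, Complex.exp_ofReal_mul_I_im]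
  have hx : ‖D‖ * Real.cos θ * Real.cos (S.f i) + ‖D‖ * Real.sin θ * Real.sin (S.f i) =
      ‖D‖ * Real.cos (2 * Real.pi * t) := by
    have : Real.cos (2 * Real.pi * t) = Real.cos (θ - S.f i) := by
      rcases S.g_eq i with hg | hg <;> rw [hθ, hg, add_sub_cancel_left] <;> push_cast
      · rw [mul_one]
      · rw [← Real.cos_neg]; congr 1; ring
    rw [this, Real.cos_sub]; ring
  have hy : (if S.g i = 1 then
      ‖D‖ * Real.sin θ * Real.cos (S.f i) - ‖D‖ * Real.cos θ * Real.sin (S.f i) else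
      0 - (‖D‖ * Real.sin θ * Real.cos (S.f i) - ‖D‖ * Real.cos θ * Real.sin (S.f i))) =
      ‖D‖ * Real.sin (2 * Real.pi * t) := by
    have h1 : ‖D‖ * Real.sin θ * Real.cos (S.f i) - ‖D‖ * Real.cos θ * Real.sin (S.f i) =
        ‖D‖ * Real.sin (θ - S.f i) := by rw [Real.sin_sub]; ring
    rw [h1]
    rcases S.g_eq i with hg | hg <;> rw [hθ, hg, add_sub_cancel_left]
    · rw [if_pos rfl]; push_cast; rw [mul_one]
    · rw [if_neg (by norm_num)]
      push_cast
      rw [show 2 * Real.pi * -1 * t = -(2 * Real.pi * t) by ring, Real.sin_neg]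
      ring
  simp only [linkKey, hre, him, hx, hy]
  exact directionKey_mul hD0 _ _

theorem exists_meets {i j : Fin n} (h : S.G.Adj i j) : ∃ t, 0 ≤ t ∧ t < 1 ∧ S.Meets t i j := by
  set D := S.center j - S.center i with hD
  have hD0 : 0 < ‖D‖ := norm_pos_iff.2 (sub_ne_zero.2 (S.center_ne h.ne'))
  have hDc : (‖D‖ : ℂ) ≠ 0 := by exact_mod_cast hD0.ne'
  have hpi := Real.pi_pos
  -- The solution of `f i + 2π (g i) s = arg D`, using that `g i` is its own inverse; its fractional
  -- part lies in the first period.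
  set s := S.g i * (D.arg - S.f i) / (2 * Real.pi) with hs
  refine ⟨Int.fract s, Int.fract_nonneg _, Int.fract_lt_one _, h, ?_⟩
  have hg : (S.g i : ℝ) * S.g i = 1 := by
    rcases S.g_eq i with h | h <;> simp [h]
  have h1 : S.link i j = circleMap (S.center i) 1 D.arg := by
    rw [link, circleMap, ← hD, Complex.ofReal_one, one_mul, add_right_inj, div_eq_iff hDc,
      mul_comm, Complex.norm_mul_exp_arg_mul_I]
  rw [h1, position, circleMap_eq_circleMap_iff _ one_ne_zero]
  refine ⟨-(S.g i * ⌊s⌋), ?_⟩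
  have h2 : S.f i + 2 * Real.pi * S.g i * Int.fract s =
      D.arg + -(S.g i * ⌊s⌋ : ℝ) * (2 * Real.pi) := by
    have h3 : 2 * Real.pi * S.g i * s = D.arg - S.f i := by
      rw [hs]; field_simp; rw [sq, hg, one_mul]
    rw [Int.fract, mul_sub, h3]; ring
  rw [h2]
  push_cast
  ring

theorem Meets.time_eq {s t : ℝ} {i j : Fin n} (h : S.Meets s i j) (h' : S.Meets t i j)
    (hs : s ∈ Set.Ico (0 : ℝ) 1) (ht : t ∈ Set.Ico (0 : ℝ) 1) : s = t :=
  timeKey_strictMonoOn.injOn hs ht (h.linkKey_eq.symm.trans h'.linkKey_eq)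

end SCS

/-! ### Frame conditions and Hoare rules with time bounds -/

namespace RealRAM

/-- `p` contains an assignment to the integer register `x`. -/
def Program.writesInt (x : ℕ) : Program → Bool
  | .setInt y _ => x == y
  | .seq p q => p.writesInt x || q.writesInt x
  | .ite _ p q => p.writesInt x || q.writesInt x
  | .while _ p => p.writesInt x
  | _ => false

/-- `p` contains an assignment to the real register `x`. -/
def Program.writesReal (x : ℕ) : Program → Bool
  | .setReal y _ => x == y
  | .seq p q => p.writesReal x || q.writesReal x
  | .ite _ p q => p.writesReal x || q.writesReal x
  | .while _ p => p.writesReal x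
  | _ => false

/-- `p` contains an assignment to an entry of the integer array `a`. -/
def Program.writesIntArr (a : ℕ) : Program → Bool
  | .storeInt b _ _ => a == b
  | .seq p q => p.writesIntArr a || q.writesIntArr a
  | .ite _ p q => p.writesIntArr a || q.writesIntArr a
  | .while _ p => p.writesIntArr a
  | _ => false

/-- `p` contains an assignment to an entry of the real array `a`. -/
def Program.writesRealArr (a : ℕ) : Program → Bool
  | .storeReal b _ _ => a == b
  | .seq p q => p.writesRealArr a || q.writesRealArr a
  | .ite _ p q => p.writesRealArr a || q.writesRealArr a
  | .while _ p => p.writesRealArr a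
  | _ => false

/-- The memories `m` and `m'` agree on everything to which `p` does not assign. -/
structure Frame (p : Program) (m m' : Mem) : Prop where
  intReg : ∀ x, p.writesInt x = false → m'.intReg x = m.intReg x
  intArr : ∀ x, p.writesIntArr x = false → m'.intArr x = m.intArr x
  realReg : ∀ x, p.writesReal x = false → m'.realReg x = m.realReg x
  realArr : ∀ x, p.writesRealArr x = false → m'.realArr x = m.realArr x

theorem Frame.refl (p : Program) (m : Mem) : Frame p m m :=
  ⟨fun _ _ => rfl, fun _ _ => rfl, fun _ _ => rfl, fun _ _ => rfl⟩

theorem Frame.trans {p : Program} {m m' m'' : Mem} (h : Frame p m m') (h' : Frame p m' m'') :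
    Frame p m m'' :=
  ⟨fun x hx => (h'.1 x hx).trans (h.1 x hx), fun x hx => (h'.2 x hx).trans (h.2 x hx),
    fun x hx => (h'.3 x hx).trans (h.3 x hx), fun x hx => (h'.4 x hx).trans (h.4 x hx)⟩

theorem Frame.mono {p q : Program} {m m' : Mem} (h : Frame p m m')
    (h1 : ∀ x, q.writesInt x = false → p.writesInt x = false)
    (h2 : ∀ x, q.writesIntArr x = false → p.writesIntArr x = false)
    (h3 : ∀ x, q.writesReal x = false → p.writesReal x = false)
    (h4 : ∀ x, q.writesRealArr x = false → p.writesRealArr x = false) : Frame q m m' :=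
  ⟨fun x hx => h.1 x (h1 x hx), fun x hx => h.2 x (h2 x hx), fun x hx => h.3 x (h3 x hx),
    fun x hx => h.4 x (h4 x hx)⟩

theorem Frame.seq_left {p q : Program} {m m' : Mem} (h : Frame p m m') :
    Frame (.seq p q) m m' := by
  apply h.mono <;> intro x hx <;>
    simp_all [Program.writesInt, Program.writesIntArr, Program.writesReal, Program.writesRealArr]

theorem Frame.seq_right {p q : Program} {m m' : Mem} (h : Frame q m m') :
    Frame (.seq p q) m m' := by
  apply h.mono <;> intro x hx <;>
    simp_all [Program.writesInt, Program.writesIntArr, Program.writesReal, Program.writesRealArr]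

theorem Frame.whileLoop {p : Program} {b : Test} {m m' : Mem} (h : Frame p m m') :
    Frame (.while b p) m m' := by
  apply h.mono <;> intro x hx <;> exact hx

/-- Memory changes only at the names to which the program text assigns. These conditions are Boolean
computations, so `rfl` settles them for concrete programs. -/
theorem Exec.frame {p : Program} {m m' : Mem} {T : ℕ} (h : Exec p m m' T) : Frame p m m' := by
  induction h with
  | skip m => exact Frame.refl _ _
  | setInt x e m =>
    refine ⟨fun y hy => ?_, fun _ _ => rfl, fun _ _ => rfl, fun _ _ => rfl⟩
    have : y ≠ x := by simpa [Program.writesInt] using hy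
    simp [Function.update_of_ne this]
  | setReal x e m =>
    refine ⟨fun _ _ => rfl, fun _ _ => rfl, fun y hy => ?_, fun _ _ => rfl⟩
    have : y ≠ x := by simpa [Program.writesReal] using hy
    simp [Function.update_of_ne this]
  | storeInt x i e m =>
    refine ⟨fun _ _ => rfl, fun y hy => ?_, fun _ _ => rfl, fun _ _ => rfl⟩
    have : y ≠ x := by simpa [Program.writesIntArr] using hy
    simp [Function.update_of_ne this]
  | storeReal x i e m =>
    refine ⟨fun _ _ => rfl, fun _ _ => rfl, fun _ _ => rfl, fun y hy => ?_⟩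
    have : y ≠ x := by simpa [Program.writesRealArr] using hy
    simp [Function.update_of_ne this]
  | seq p q m m' m'' T T' _ _ ih ih' => exact ih.seq_left.trans ih'.seq_right
  | iteTrue b p q m m' T _ _ ih =>
    apply ih.mono <;> intro x hx <;> simp_all [Program.writesInt, Program.writesIntArr,
      Program.writesReal, Program.writesRealArr]
  | iteFalse b p q m m' T _ _ ih =>
    apply ih.mono <;> intro x hx <;> simp_all [Program.writesInt, Program.writesIntArr,
      Program.writesReal, Program.writesRealArr]
  | whileTrue b p m m' m'' T T' _ _ _ ih ih' => exact ih.whileLoop.trans ih'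
  | whileFalse b p m _ => exact Frame.refl _ _

/-- Started with the memory `m`, the program `p` halts after at most `B` steps with a memory that
satisfies `Q`. -/
def Runs (p : Program) (m : Mem) (B : ℕ) (Q : Mem → Prop) : Prop :=
  ∃ m' T, Exec p m m' T ∧ T ≤ B ∧ Q m'

theorem Runs.imp {p : Program} {m : Mem} {B B' : ℕ} {Q Q' : Mem → Prop} (h : Runs p m B Q)
    (hB : B ≤ B') (hQ : ∀ m', Frame p m m' → Q m' → Q' m') : Runs p m B' Q' := by
  obtain ⟨m', T, h1, h2, h3⟩ := h
  exact ⟨m', T, h1, h2.trans hB, hQ m' h1.frame h3⟩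

theorem Runs.seq {p q : Program} {m : Mem} {B B' : ℕ} {R Q : Mem → Prop} (h : Runs p m B R)
    (h' : ∀ m', Frame p m m' → R m' → Runs q m' B' Q) : Runs (.seq p q) m (B + B') Q := by
  obtain ⟨m', T, h1, h2, h3⟩ := h
  obtain ⟨m'', T', h1', h2', h3'⟩ := h' m' h1.frame h3
  exact ⟨m'', T + T', .seq _ _ _ _ _ _ _ h1 h1', add_le_add h2 h2', h3'⟩

/-- `p` contains no loop. -/
def Program.loopFree : Program → Bool
  | .seq p q => p.loopFree && q.loopFree
  | .ite _ p q => p.loopFree && q.loopFree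
  | .while _ _ => false
  | _ => true

/-- An upper bound for the number of steps of a program without loops. -/
def Program.bound : Program → ℕ
  | .skip => 1
  | .setInt _ e => e.cost + 1
  | .setReal _ e => e.cost + 1
  | .storeInt _ i e => i.cost + e.cost + 1
  | .storeReal _ i e => i.cost + e.cost + 1
  | .seq p q => p.bound + q.bound
  | .ite b p q => b.cost + (p.bound + q.bound)
  | .while _ _ => 0

open Classical in
/-- The result of a program without loops. -/
noncomputable def Program.run : Program → Mem → Mem
  | .skip, m => m
  | .setInt x e, m => { m with intReg := Function.update m.intReg x (e.eval m) }
  | .setReal x e, m => { m with realReg := Function.update m.realReg x (e.eval m) }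
  | .storeInt a i e, m => { m with
      intArr := Function.update m.intArr a
        (Function.update (m.intArr a) (i.eval m) (e.eval m)) }
  | .storeReal a i e, m => { m with
      realArr := Function.update m.realArr a
        (Function.update (m.realArr a) (i.eval m) (e.eval m)) }
  | .seq p q, m => q.run (p.run m)
  | .ite b p q, m => if b.eval m then p.run m else q.run m
  | .while _ _, m => m

theorem Program.exec_run {p : Program} (hp : p.loopFree = true) (m : Mem) :
    ∃ T, Exec p m (p.run m) T ∧ T ≤ p.bound := by
  induction p generalizing m with
  | skip => exact ⟨_, .skip m, le_rfl⟩
  | setInt x e => exact ⟨_, .setInt x e m, le_rfl⟩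
  | setReal x e => exact ⟨_, .setReal x e m, le_rfl⟩
  | storeInt a i e => exact ⟨_, .storeInt a i e m, le_rfl⟩
  | storeReal a i e => exact ⟨_, .storeReal a i e m, le_rfl⟩
  | seq p q ihp ihq =>
    simp only [loopFree, Bool.and_eq_true] at hp
    obtain ⟨T, h1, h2⟩ := ihp hp.1 m
    obtain ⟨T', h1', h2'⟩ := ihq hp.2 (p.run m)
    exact ⟨_, .seq _ _ _ _ _ _ _ h1 h1', add_le_add h2 h2'⟩
  | ite b p q ihp ihq =>
    simp only [loopFree, Bool.and_eq_true] at hp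
    by_cases hb : b.eval m
    · obtain ⟨T, h1, h2⟩ := ihp hp.1 m
      rw [run, if_pos hb, bound]
      exact ⟨_, .iteTrue _ _ _ _ _ _ hb h1, by omega⟩
    · obtain ⟨T, h1, h2⟩ := ihq hp.2 m
      rw [run, if_neg hb, bound]
      exact ⟨_, .iteFalse _ _ _ _ _ _ hb h1, by omega⟩
  | _ => simp [loopFree] at hp

/-- Loop-free code is executed symbolically: `run` unfolds by `simp`, and the time bound is computed
from the text alone. -/
theorem Runs.of_loopFree {p : Program} (hp : p.loopFree = true) {m : Mem} {Q : Mem → Prop}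
    (hQ : Q (p.run m)) : Runs p m p.bound Q := by
  obtain ⟨T, h1, h2⟩ := p.exec_run hp m
  exact ⟨_, T, h1, h2, hQ⟩

/-- `for x := 0 to y - 1 do p`, with registers `x` and `y`. -/
def forLoop (x y : ℕ) (p : Program) : Program :=
  .seq (.setInt x (.const 0)) (.while (.intLt (.reg x) (.reg y))
    (.seq p (.setInt x (.add (.reg x) (.const 1)))))

/-- The rule for loops. The invariant `I i t` says that the body was executed `i` times, in `t`
steps. -/
theorem Runs.forLoop {x y : ℕ} {p : Program} {m : Mem} {B : ℕ} (hxy : (y == x) = false)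
    (hx : p.writesInt x = false) (hy : p.writesInt y = false) (I : ℕ → ℕ → Mem → Prop)
    (h0 : I 0 0 m)
    (hI : ∀ i t m' v, I i t m' → I i t { m' with intReg := Function.update m'.intReg x v })
    (hstep : ∀ i t m', i < m.intReg y → m'.intReg x = i → Frame (RealRAM.forLoop x y p) m m' →
      I i t m' → ∃ b, Runs p m' b fun m'' => I (i + 1) (t + b) m'')
    (hB : ∀ t m', I (m.intReg y) t m' → t ≤ B) :
    Runs (RealRAM.forLoop x y p) m (B + 7 * m.intReg y + 5) fun m' =>
      ∃ t, I (m.intReg y) t m' := by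
  have hyx : y ≠ x := by simpa using hxy
  set N := m.intReg y with hN
  have hyfor : (RealRAM.forLoop x y p).writesInt y = false := by
    simp [RealRAM.forLoop, Program.writesInt, hyx, hy]
  -- Here `d` is the number of remaining iterations. A test costs 3 and the increment 4, hence 7 per
  -- iteration; the last, failing test costs 3 and the initial assignment 2, hence the final 5.
  have key : ∀ d i t m', i + d = N → m'.intReg x = i → Frame (RealRAM.forLoop x y p) m m' →
      I i t m' → ∃ m'' t' T, Exec (.while (.intLt (.reg x) (.reg y))
        (.seq p (.setInt x (.add (.reg x) (.const 1))))) m' m'' T ∧ I N t' m'' ∧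
        T + t ≤ t' + 7 * d + 3 := by
    intro d
    induction d with
    | zero =>
      intro i t m' hi hmx hF hIi
      refine ⟨m', t, 3, .whileFalse _ _ _ ?_, ?_, by omega⟩
      · have := hF.1 y hyfor
        simp only [Test.eval, IntExp.eval]
        omega
      · rwa [← hi]
    | succ d ih =>
      intro i t m' hi hmx hF hIi
      obtain ⟨b, m1, T1, he1, hT1, hI1⟩ := hstep i t m' (by omega) hmx hF hIi
      have hm1x : m1.intReg x = i := (he1.frame.1 x hx).trans hmx
      have he2 := Exec.setInt x (.add (.reg x) (.const 1)) m1
      have he3 := Exec.seq _ _ _ _ _ _ _ he1 he2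
      obtain ⟨m3, t', T3, he4, hI3, hT3⟩ := ih (i + 1) (t + b) _ (by omega)
        (by simp [IntExp.eval, hm1x]) (hF.trans (he3.frame.whileLoop.seq_right)) (hI _ _ _ _ hI1)
      refine ⟨m3, t', _, .whileTrue _ _ _ _ _ _ _ ?_ he3 he4, hI3, ?_⟩
      · have := hF.1 y hyfor
        simp only [Test.eval, IntExp.eval]
        omega
      · simp only [Test.cost, IntExp.cost]
        omega
  have he0 := Exec.setInt x (.const 0) m
  obtain ⟨m', t, T, h1, h2, h3⟩ := key N 0 0 _ (by omega)
    (by simp [IntExp.eval]) he0.frame.seq_left (hI _ _ _ _ h0)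
  refine ⟨m', _, .seq _ _ _ _ _ _ _ he0 h1, ?_, t, h2⟩
  have := hB _ _ h2
  simp only [IntExp.cost]
  omega

/-- The rule for loops with a uniform bound for the body. -/
theorem Runs.forLoop_uniform {x y : ℕ} {p : Program} {m : Mem} {b N B : ℕ} {Q : Mem → Prop}
    (hxy : (y == x) = false) (hx : p.writesInt x = false) (hy : p.writesInt y = false)
    (hN : m.intReg y = N) (hB : (b + 7) * N + 5 ≤ B) (I : ℕ → Mem → Prop) (h0 : I 0 m)
    (hI : ∀ i m' v, I i m' → I i { m' with intReg := Function.update m'.intReg x v })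
    (hstep : ∀ i m', i < N → m'.intReg x = i → Frame (RealRAM.forLoop x y p) m m' →
      I i m' → Runs p m' b (I (i + 1)))
    (hQ : ∀ m', Frame (RealRAM.forLoop x y p) m m' → I N m' → Q m') :
    Runs (RealRAM.forLoop x y p) m B Q := by
  subst hN
  have := Runs.forLoop (B := b * m.intReg y) hxy hx hy (fun i t m' => t ≤ b * i ∧ I i m')
    ⟨by simp, h0⟩ (fun i t m' v h => ⟨h.1, hI i m' v h.2⟩)
    (fun i t m' hi hm hF h => ⟨b, (hstep i m' hi hm hF h.2).imp le_rfl fun m'' _ h' =>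
      ⟨by have := h.1; rw [mul_add_one]; omega, h'⟩⟩) (fun t m' h => h.1)
  exact this.imp (by rw [add_mul] at hB; exact hB) fun m' hF ⟨t, h⟩ => hQ m' hF h.2

-- First phase: tables and the list of edges

infixr:67 " ;; " => Program.seq

/-- Puts `i * n` and `i` into the entries `i < n` of the integer arrays `3` and `4`. -/
def initTables : Program :=
  .setInt 5 (.const 0) ;; forLoop 4 0 (.storeInt 3 (.reg 4) (.reg 5) ;;
    .storeInt 4 (.reg 4) (.reg 4) ;; .setInt 5 (.add (.reg 5) (.reg 0)))

/-- Integers cannot be multiplied on this machine, so the row offsets `i * n` are obtained by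
repeated addition. Array `4` starts as the identity because at time 0 each trajectory contains its
own robot. -/
theorem runs_initTables {m : Mem} {n : ℕ} (hn : m.intReg 0 = n) :
    Runs initTables m (24 * n + 10) fun m' =>
      ∀ i < n, m'.intArr 3 i = i * n ∧ m'.intArr 4 i = i := by
  refine (Runs.seq (Runs.of_loopFree rfl (Q := fun m' => m'.intReg 5 = 0) (by
    simp [Program.run, IntExp.eval])) fun m1 hF1 h5 => Runs.forLoop_uniform (b := 13) (N := n)
    rfl rfl rfl ((hF1.1 0 rfl).trans hn) le_rfl (fun i m' => m'.intReg 5 = i * n ∧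
      ∀ j < i, m'.intArr 3 j = j * n ∧ m'.intArr 4 j = j) ?_ ?_ ?_ ?_).imp ?_ fun _ _ h => h
  · exact ⟨by simp [h5], by simp⟩
  · simp
  · rintro i m' hi hm' hF ⟨h1, h2⟩
    have hn : m'.intReg 0 = n := by rw [hF.1 0 rfl, hF1.1 0 rfl, hn]
    refine (Runs.of_loopFree rfl ?_).imp (Q := fun m'' => m''.intReg 5 = (i + 1) * n ∧
      ∀ j < i + 1, m''.intArr 3 j = j * n ∧ m''.intArr 4 j = j) (by decide)
      fun _ _ h => h
    simp only [Program.run, IntExp.eval]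
    refine ⟨by simp [h1, hn, add_mul], fun j hj => ?_⟩
    by_cases hji : j = i
    · subst hji
      simp [hm', h1]
    · have := h2 j (by omega)
      simpa [hm', hji] using this
  · exact fun m' _ h => h.2
  · simp only [Program.bound, IntExp.cost]
    omega

/-- Puts into the real registers `3` and `4` the coordinates of a vector whose direction is the
angle from the starting position in the trajectory in register `4` to its link with the trajectory
in register `7`. -/
def linkVector : Program :=
  .setReal 6 (.sub (.arr 0 (.reg 7)) (.arr 0 (.reg 4))) ;;
  .setReal 7 (.sub (.arr 1 (.reg 7)) (.arr 1 (.reg 4))) ;;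
  .setReal 3 (.add (.mul (.reg 6) (.arr 2 (.reg 4))) (.mul (.reg 7) (.arr 3 (.reg 4)))) ;;
  .setReal 4 (.sub (.mul (.reg 7) (.arr 2 (.reg 4))) (.mul (.reg 6) (.arr 3 (.reg 4)))) ;;
  .ite (.intEq (.arr 1 (.reg 4)) (.const 1)) .skip (.setReal 4 (.sub (.const 0) (.reg 4)))

/-- Puts into the real register `5` the key of the vector in the real registers `3` and `4`. -/
def vectorKey : Program :=
  .setReal 5 (.div (.mul (.reg 3) (.reg 3))
    (.add (.mul (.reg 3) (.reg 3)) (.mul (.reg 4) (.reg 4)))) ;;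
  .ite (.realLt (.reg 3) (.const 0)) (.setReal 5 (.sub (.const 0) (.reg 5))) .skip ;;
  .ite (.realLt (.reg 4) (.const 0)) (.setReal 5 (.add (.const 3) (.reg 5)))
    (.setReal 5 (.sub (.const 1) (.reg 5)))

/-- Appends the edge with ends in the registers `4` and `7` and with its key in the real register
`5` to the list of edges in the integer arrays `5` and `6` and the real array `4`. -/
def storeEdge : Program :=
  .storeInt 5 (.reg 6) (.reg 4) ;; .storeInt 6 (.reg 6) (.reg 7) ;;
  .storeReal 4 (.reg 6) (.reg 5) ;; .setInt 6 (.add (.reg 6) (.const 1))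

theorem runs_linkVector (m : Mem) {i j : ℕ} (hi : m.intReg 4 = i) (hj : m.intReg 7 = j) :
    Runs linkVector m linkVector.bound fun m' =>
      let dx := m.realArr 0 j - m.realArr 0 i
      let dy := m.realArr 1 j - m.realArr 1 i
      let y := dy * m.realArr 2 i - dx * m.realArr 3 i
      m'.realReg 3 = dx * m.realArr 2 i + dy * m.realArr 3 i ∧
      m'.realReg 4 = if m.intArr 1 i = 1 then y else 0 - y := by
  refine Runs.of_loopFree rfl ?_
  subst hi hj
  by_cases h1 : m.intArr 1 (m.intReg 4) = 1 <;>
    simp [linkVector, Program.run, IntExp.eval, RealExp.eval, Test.eval, h1]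

theorem runs_vectorKey (m : Mem) :
    Runs vectorKey m vectorKey.bound fun m' =>
      m'.realReg 5 = directionKey (m.realReg 3) (m.realReg 4) := by
  refine Runs.of_loopFree rfl ?_
  by_cases h1 : m.realReg 3 < 0 <;> by_cases h2 : m.realReg 4 < 0 <;>
    simp [vectorKey, Program.run, RealExp.eval, Test.eval, h1, h2, directionKey]

/-- The memory holds the given system of `n` robots: the parts of the input that the program never
changes. -/
structure HoldsSystem {n : ℕ} (S : SCS n) (m : Mem) : Prop where
  size : m.intReg 0 = n
  adj : ∀ i j : Fin n, m.intArr 0 (i * n + j) = 1 ↔ S.G.Adj i j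
  dir : ∀ i : Fin n, m.intArr 1 i = 1 ↔ S.g i = 1
  re : ∀ i : Fin n, m.realArr 0 i = (S.center i).re
  im : ∀ i : Fin n, m.realArr 1 i = (S.center i).im
  cos : ∀ i : Fin n, m.realArr 2 i = Real.cos (S.f i)
  sin : ∀ i : Fin n, m.realArr 3 i = Real.sin (S.f i)

theorem index_inj {n : ℕ} {i j x y : Fin n} : (i * n + j : ℕ) = x * n + y ↔ i = x ∧ j = y := by
  refine ⟨fun he => ?_, fun ⟨h1, h2⟩ => h1 ▸ h2 ▸ rfl⟩
  have hn : 0 < n := i.pos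
  have h1 : i = x := by
    have := congrArg (· / n) he
    simp only [mul_comm _ n, Nat.mul_add_div hn, Nat.div_eq_of_lt j.2, Nat.div_eq_of_lt y.2,
      add_zero] at this
    exact Fin.ext this
  subst h1
  exact ⟨rfl, Fin.ext (by omega)⟩

theorem holdsSystem_input {n : ℕ} (S : SCS n) (k : ℕ) : HoldsSystem S (input S k) where
  size := by simp [input]
  adj i j := by
    have : (∃ i' j' : Fin n, S.G.Adj i' j' ∧ (i * n + j : ℕ) = i' * n + j') ↔ S.G.Adj i j := by
      refine ⟨fun ⟨i', j', h, he⟩ => ?_, fun h => ⟨i, j, h, rfl⟩⟩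
      obtain ⟨rfl, rfl⟩ := index_inj.1 he
      exact h
    simp [input, this]
  dir i := by simp [input, ofVec]
  re i := by simp [input, ofVec]
  im i := by simp [input, ofVec]
  cos i := by simp [input, ofVec]
  sin i := by simp [input, ofVec]

theorem HoldsSystem.frame {n : ℕ} {S : SCS n} {m m' : Mem} {p : Program} (h : HoldsSystem S m)
    (hF : Frame p m m') (h0 : p.writesInt 0 = false) (ha0 : p.writesIntArr 0 = false)
    (ha1 : p.writesIntArr 1 = false) (hr0 : p.writesRealArr 0 = false)
    (hr1 : p.writesRealArr 1 = false) (hr2 : p.writesRealArr 2 = false)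
    (hr3 : p.writesRealArr 3 = false) : HoldsSystem S m' where
  size := by rw [hF.1 0 h0, h.size]
  adj i j := by rw [hF.2 0 ha0, h.adj]
  dir i := by rw [hF.2 1 ha1, h.dir]
  re i := by rw [hF.4 0 hr0, h.re]
  im i := by rw [hF.4 1 hr1, h.im]
  cos i := by rw [hF.4 2 hr2, h.cos]
  sin i := by rw [hF.4 3 hr3, h.sin]

/-- The pair `(u, v)` precedes the pair `(i, j)` lexicographically. -/
def Before (u v i j : ℕ) : Prop := u < i ∨ u = i ∧ v < j

/-- A list without repetitions of the edges that precede `(i, j)`, with their keys. -/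
structure EdgeList {n : ℕ} (S : SCS n) (E : ℕ) (eu ev : ℕ → ℕ) (key : ℕ → ℝ) (i j : ℕ) :
    Prop where
  sound : ∀ e < E, ∃ u v : Fin n, v < u ∧ S.G.Adj u v ∧ Before u v i j ∧ eu e = u ∧ ev e = v ∧
    key e = S.linkKey u v
  complete : ∀ u v : Fin n, v < u → S.G.Adj u v → Before u v i j → ∃ e < E, eu e = u ∧ ev e = v
  inj : ∀ e < E, ∀ e' < E, eu e = eu e' → ev e = ev e' → e = e'

/-- Used when the position advances without a new edge: past a nonadjacent pair, and from the end of
row `i` to the start of row `i + 1`. -/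
theorem EdgeList.congr {n : ℕ} {S : SCS n} {E : ℕ} {eu ev : ℕ → ℕ} {key : ℕ → ℝ} {i j i' j' : ℕ}
    (h : EdgeList S E eu ev key i j)
    (hb : ∀ u v : Fin n, v < u → S.G.Adj u v → (Before u v i j ↔ Before u v i' j')) :
    EdgeList S E eu ev key i' j' where
  sound e he := by
    obtain ⟨u, v, h1, h2, h3, h4⟩ := h.sound e he
    exact ⟨u, v, h1, h2, (hb u v h1 h2).1 h3, h4⟩
  complete u v h1 h2 h3 := h.complete u v h1 h2 ((hb u v h1 h2).2 h3)
  inj := h.inj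

/-- The new entry repeats no old one, since all listed pairs strictly precede `(i, j)`. -/
theorem EdgeList.append {n : ℕ} {S : SCS n} {E : ℕ} {eu ev : ℕ → ℕ} {key : ℕ → ℝ} {i j : Fin n}
    (h : EdgeList S E eu ev key i j) (hji : j < i) (ha : S.G.Adj i j) :
    EdgeList S (E + 1) (Function.update eu E i) (Function.update ev E j)
      (Function.update key E (S.linkKey i j)) i (j + 1) where
  sound e he := by
    by_cases heE : e = E
    · subst heE
      exact ⟨i, j, hji, ha, Or.inr ⟨rfl, Nat.lt_succ_self _⟩, by simp⟩
    · obtain ⟨u, v, h1, h2, h3, h4⟩ := h.sound e (by omega)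
      exact ⟨u, v, h1, h2, by unfold Before at *; omega, by simpa [heE] using h4⟩
  complete u v h1 h2 h3 := by
    by_cases hb : Before u v i j
    · obtain ⟨e, he, h4⟩ := h.complete u v h1 h2 hb
      exact ⟨e, by omega, by simpa [he.ne] using h4⟩
    · refine ⟨E, Nat.lt_succ_self _, ?_⟩
      simp only [Function.update_self]
      unfold Before at *
      omega
  inj := by
    have key : ∀ e < E, eu e = i → ev e = j → False := by
      intro e he h1 h2
      obtain ⟨u, v, -, -, h5, h6, h7, -⟩ := h.sound e he
      unfold Before at h5
      omega
    intro e he e' he' h1 h2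
    by_cases heE : e = E <;> by_cases heE' : e' = E
    · rw [heE, heE']
    · subst heE
      simp only [Function.update_self, Function.update_of_ne heE'] at h1 h2
      exact (key e' (by omega) h1.symm h2.symm).elim
    · subst heE'
      simp only [Function.update_self, Function.update_of_ne heE] at h1 h2
      exact (key e (by omega) h1 h2).elim
    · simp only [Function.update_of_ne heE, Function.update_of_ne heE'] at h1 h2
      exact h.inj e (by omega) e' (by omega) h1 h2

/-- Bounded degree makes the number of links linear in `n`; only for this reason is a simulation
that is quadratic in the number of links affordable. -/
theorem EdgeList.card_le {n : ℕ} {S : SCS n} {E : ℕ} {eu ev : ℕ → ℕ} {key : ℕ → ℝ} {i j : ℕ}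
    (h : EdgeList S E eu ev key i j) : E ≤ 36 * n := by
  classical
  let A : Finset (Σ _ : Fin n, Fin n) := Finset.univ.sigma fun u => Finset.univ.filter (S.G.Adj u)
  have h1 : A.card ≤ 36 * n := by
    rw [Finset.card_sigma]
    refine (Finset.sum_le_sum fun u _ => SCS.card_neighbors_le (S := S) u _ fun j hj =>
      (Finset.mem_filter.1 hj).2).trans ?_
    simp [mul_comm]
  have hs := fun e : Fin E => h.sound e e.2
  choose U V hU using hs
  have h2 : (Finset.univ : Finset (Fin E)).card ≤ A.card := by
    refine Finset.card_le_card_of_injOn (fun e => ⟨U e, V e⟩) (fun e _ => ?_) ?_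
    · simpa [A] using (hU e).2.1
    · intro e _ e' _ hee
      simp only [Sigma.mk.injEq, heq_eq_eq] at hee
      refine Fin.ext (h.inj e e.2 e' e'.2 ?_ ?_)
      · rw [(hU e).2.2.2.1, (hU e').2.2.2.1, hee.1]
      · rw [(hU e).2.2.2.2.1, (hU e').2.2.2.2.1, hee.2]
  rw [Finset.card_univ, Fintype.card_fin] at h2
  exact h2.trans h1

/-- If the trajectories in the registers `4` and `7` are adjacent, appends this edge to the list. -/
def tryEdge : Program :=
  .setInt 12 (.arr 0 (.add (.arr 3 (.reg 4)) (.reg 7))) ;; linkVector ;; vectorKey ;;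
    .ite (.intEq (.reg 12) (.const 1)) storeEdge .skip

/-- Lists all edges. -/
def listEdges : Program := .setInt 6 (.const 0) ;; forLoop 4 0 (forLoop 7 4 tryEdge)

theorem runs_tryEdge {n : ℕ} {S : SCS n} {m : Mem} {i j : ℕ} (hS : HoldsSystem S m)
    (htab : ∀ i < n, m.intArr 3 i = i * n) (hi : m.intReg 4 = i) (hj : m.intReg 7 = j)
    (hin : i < n) (hji : j < i)
    (hE : EdgeList S (m.intReg 6) (m.intArr 5) (m.intArr 6) (m.realArr 4) i j) :
    Runs tryEdge m tryEdge.bound fun m' =>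
      EdgeList S (m'.intReg 6) (m'.intArr 5) (m'.intArr 6) (m'.realArr 4) i (j + 1) := by
  let u : Fin n := ⟨i, hin⟩
  let v : Fin n := ⟨j, hji.trans hin⟩
  refine Runs.seq (Runs.of_loopFree rfl (Q := fun m' => m'.intReg 12 = 1 ↔ S.G.Adj u v) ?_)
    fun m1 hF1 h12 => Runs.seq (runs_linkVector m1 (i := i) (j := j) ((hF1.1 4 rfl).trans hi)
      ((hF1.1 7 rfl).trans hj))
    fun m2 hF2 hvec => Runs.seq (runs_vectorKey m2)
    fun m3 hF3 hkey => ?_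
  · rw [← hS.adj]
    simp [Program.run, IntExp.eval, hi, hj, htab i hin, u, v]
  rw [hF1.4 0 rfl, hF1.4 1 rfl, hF1.4 2 rfl, hF1.4 3 rfl, hF1.2 1 rfl] at hvec
  have hkey' : m3.realReg 5 = S.linkKey u v := by
    rw [hkey, hvec.1, hvec.2, SCS.linkKey]
    simp only [← hS.re, ← hS.im, ← hS.cos, ← hS.sin, ← hS.dir, u, v]
  have e4 : m3.intReg 4 = i := by rw [hF3.1 4 rfl, hF2.1 4 rfl, hF1.1 4 rfl, hi]
  have e7 : m3.intReg 7 = j := by rw [hF3.1 7 rfl, hF2.1 7 rfl, hF1.1 7 rfl, hj]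
  have e12 : m3.intReg 12 = 1 ↔ S.G.Adj u v := by rw [hF3.1 12 rfl, hF2.1 12 rfl, h12]
  rw [← hF1.1 6 rfl, ← hF2.1 6 rfl, ← hF3.1 6 rfl, ← hF1.2 5 rfl, ← hF2.2 5 rfl, ← hF3.2 5 rfl,
    ← hF1.2 6 rfl, ← hF2.2 6 rfl, ← hF3.2 6 rfl, ← hF1.4 4 rfl, ← hF2.4 4 rfl,
    ← hF3.4 4 rfl] at hE
  refine Runs.of_loopFree rfl ?_
  by_cases ha : S.G.Adj u v
  · simp [Program.run, Test.eval, IntExp.eval, RealExp.eval, storeEdge, e4, e7, e12, ha, hkey']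
    exact EdgeList.append (i := u) (j := v) hE hji ha
  · simp only [Program.run, Test.eval, IntExp.eval, e12, ha, if_false]
    refine hE.congr fun u' v' h1 h2 => ?_
    have : ¬ (u' = u ∧ v' = v) := fun ⟨h3, h4⟩ => ha (h3 ▸ h4 ▸ h2)
    simp only [Fin.ext_iff, u, v] at this
    unfold Before
    omega

theorem runs_listEdges {n : ℕ} {S : SCS n} {m : Mem} (hS : HoldsSystem S m)
    (htab : ∀ i < n, m.intArr 3 i = i * n) :
    Runs listEdges m (((tryEdge.bound + 7) * n + 5 + 7) * n + 7) fun m' =>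
      EdgeList S (m'.intReg 6) (m'.intArr 5) (m'.intArr 6) (m'.realArr 4) n 0 := by
  refine (Runs.seq (Runs.of_loopFree rfl (Q := fun m' => m'.intReg 6 = 0) (by
    simp [Program.run, IntExp.eval])) fun m1 hF1 h6 => Runs.forLoop_uniform (N := n)
    (b := (tryEdge.bound + 7) * n + 5)
    rfl rfl rfl ((hF1.1 0 rfl).trans hS.size) le_rfl (fun i m' =>
      EdgeList S (m'.intReg 6) (m'.intArr 5) (m'.intArr 6) (m'.realArr 4) i 0) ?_ ?_ ?_ ?_).imp ?_
      fun _ _ h => h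
  · rw [h6]
    exact ⟨by simp, fun u v _ _ h => by simp [Before] at h, by simp⟩
  · simp
  · intro i m2 hi h4 hF2 hE
    refine Runs.forLoop_uniform (N := i) (b := tryEdge.bound) rfl rfl rfl h4 (by gcongr)
      (fun j m' => EdgeList S (m'.intReg 6) (m'.intArr 5) (m'.intArr 6) (m'.realArr 4) i j)
      hE ?_ ?_ ?_
    · simp
    · intro j m3 hj h7 hF3 hE'
      refine runs_tryEdge (((hS.frame hF1 rfl rfl rfl rfl rfl rfl rfl).frame hF2 rfl rfl rfl rfl
        rfl rfl rfl).frame hF3 rfl rfl rfl rfl rfl rfl rfl) ?_ ?_ h7 hi hj hE'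
      · rwa [hF3.2 3 rfl, hF2.2 3 rfl, hF1.2 3 rfl]
      · rw [hF3.1 4 rfl, h4]
    · intro m3 _ hE'
      refine hE'.congr fun u v h1 h2 => ?_
      unfold Before
      omega
  · exact fun m' _ h => h
  · simp only [Program.bound, IntExp.cost]
    omega

end RealRAM

/-! ### First phase: simulating one period -/

/-- An enumeration of the links reached by the schedule in the time interval `[0, 1)`: at time
`τ e`, the link between `U e` and `V e` is reached. -/
structure SCS.Timeline {n : ℕ} (S : SCS n) (E : ℕ) (U V : ℕ → Fin n) (τ : ℕ → ℝ) : Prop where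
  mem : ∀ e < E, τ e ∈ Set.Ico (0 : ℝ) 1
  meets : ∀ e < E, S.Meets (τ e) (U e) (V e)
  complete : ∀ t ∈ Set.Ico (0 : ℝ) 1, ∀ u v, S.Meets t u v →
    ∃ e < E, τ e = t ∧ (U e = u ∧ V e = v ∨ U e = v ∧ V e = u)
  disjoint : ∀ e < E, ∀ e' < E, τ e = τ e' → e ≠ e' →
    U e ≠ U e' ∧ U e ≠ V e' ∧ V e ≠ U e' ∧ V e ≠ V e'

namespace RealRAM

/-- The true times exist although the machine sees only their keys. Links reached at the same time
share no trajectory, because a trajectory has at most one partner at a time. -/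
theorem EdgeList.exists_timeline {n : ℕ} {S : SCS n} {E : ℕ} {eu ev : ℕ → ℕ} {key : ℕ → ℝ}
    (h : EdgeList S E eu ev key n 0) : ∃ (U V : ℕ → Fin n) (τ : ℕ → ℝ), S.Timeline E U V τ ∧
      ∀ e < E, eu e = U e ∧ ev e = V e ∧ key e = timeKey (τ e) := by
  have hn : Nonempty (Fin n) := S.connected.nonempty
  have h1 : ∀ e, ∃ (u v : Fin n) (t : ℝ), e < E → v < u ∧ t ∈ Set.Ico (0 : ℝ) 1 ∧ S.Meets t u v ∧
      eu e = u ∧ ev e = v ∧ key e = timeKey t := by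
    intro e
    by_cases he : e < E
    · obtain ⟨u, v, h1, h2, -, h3, h4, h5⟩ := h.sound e he
      obtain ⟨t, h6, h7, h8⟩ := SCS.exists_meets h2
      exact ⟨u, v, t, fun _ => ⟨h1, ⟨h6, h7⟩, h8, h3, h4, h5.trans h8.linkKey_eq⟩⟩
    · exact ⟨hn.some, hn.some, 0, fun he' => absurd he' he⟩
  choose U V τ hU using h1
  have before : ∀ u v : Fin n, Before u v n 0 := fun u v => Or.inl u.2
  refine ⟨U, V, τ, ⟨fun e he => (hU e he).2.1, fun e he => (hU e he).2.2.1, ?_, ?_⟩,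
    fun e he => (hU e he).2.2.2⟩
  · intro t ht u v hm
    rcases lt_trichotomy v u with huv | rfl | huv
    · obtain ⟨e, he, h1, h2⟩ := h.complete u v huv hm.1 (before u v)
      obtain ⟨-, h3, h4, h5, h6, -⟩ := hU e he
      have hu : U e = u := Fin.ext (h5.symm.trans h1)
      have hv : V e = v := Fin.ext (h6.symm.trans h2)
      exact ⟨e, he, SCS.Meets.time_eq (hu ▸ hv ▸ h4) hm h3 ht, Or.inl ⟨hu, hv⟩⟩
    · exact (hm.1.ne rfl).elim
    · obtain ⟨e, he, h1, h2⟩ := h.complete v u huv hm.symm.1 (before v u)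
      obtain ⟨-, h3, h4, h5, h6, -⟩ := hU e he
      have hu : U e = v := Fin.ext (h5.symm.trans h1)
      have hv : V e = u := Fin.ext (h6.symm.trans h2)
      exact ⟨e, he, SCS.Meets.time_eq (hu ▸ hv ▸ h4) hm.symm h3 ht, Or.inr ⟨hu, hv⟩⟩
  · intro e he e' he' ht hne
    obtain ⟨l, -, m, h1, h2, -⟩ := hU e he
    obtain ⟨l', -, m', h1', h2', -⟩ := hU e' he'
    rw [← ht] at m'
    have key : U e = U e' → V e = V e' → False := fun hu hv =>
      hne (h.inj e he e' he' (by rw [h1, h1', hu]) (by rw [h2, h2', hv]))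
    refine ⟨fun hu => ?_, fun hu => ?_, fun hu => ?_, fun hu => ?_⟩
    · exact key hu (SCS.Meets.unique m (hu ▸ m'))
    -- The same link would be listed with both orientations, but each edge is listed with its larger
    -- end first.
    · have := SCS.Meets.unique m (hu ▸ m'.symm)
      rw [hu, this] at l
      exact lt_asymm l l'
    · have := SCS.Meets.unique m.symm (hu ▸ m')
      rw [hu, this] at l
      exact lt_asymm l l'
    · exact key (SCS.Meets.unique m.symm (hu ▸ m'.symm)) hu

/-- Puts into the real register `2` the least key above the real register `1`. -/
def nextKey : Program :=
  .setReal 2 (.const 5) ;; forLoop 9 6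
    (.ite (.and (.realLt (.reg 1) (.arr 4 (.reg 9))) (.realLt (.arr 4 (.reg 9)) (.reg 2)))
      (.setReal 2 (.arr 4 (.reg 9))) .skip)

/-- The value 5 serves as infinity: link keys are at most 4. -/
theorem runs_nextKey {m : Mem} {E : ℕ} (hE : m.intReg 6 = E)
    (hkey : ∀ e < E, m.realArr 4 e < 5) :
    Runs nextKey m (22 * E + 7) fun m' =>
      m'.realReg 2 = 5 ∧ (∀ e < E, m.realArr 4 e ≤ m.realReg 1) ∨
      ∃ e < E, m'.realReg 2 = m.realArr 4 e ∧ m.realReg 1 < m.realArr 4 e ∧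
        ∀ e' < E, m.realReg 1 < m.realArr 4 e' → m.realArr 4 e ≤ m.realArr 4 e' := by
  refine (Runs.seq (Runs.of_loopFree rfl (Q := fun m' => m'.realReg 2 = 5) (by
    simp [Program.run, RealExp.eval])) fun m1 hF1 h2 => Runs.forLoop_uniform (N := E) (b := 15)
    rfl rfl rfl ((hF1.1 6 rfl).trans hE) le_rfl (fun i m' =>
      m'.realReg 2 = 5 ∧ (∀ e < i, m.realArr 4 e ≤ m.realReg 1) ∨
      ∃ e < i, m'.realReg 2 = m.realArr 4 e ∧ m.realReg 1 < m.realArr 4 e ∧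
        ∀ e' < i, m.realReg 1 < m.realArr 4 e' → m.realArr 4 e ≤ m.realArr 4 e') ?_ ?_ ?_ ?_).imp
      ?_ fun _ _ h => h
  · exact Or.inl ⟨h2, by simp⟩
  · simp
  · intro i m' hi h9 hF h
    have e1 : m'.realReg 1 = m.realReg 1 := by rw [hF.3 1 rfl, hF1.3 1 rfl]
    have e4 : m'.realArr 4 = m.realArr 4 := by rw [hF.4 4 rfl, hF1.4 4 rfl]
    refine (Runs.of_loopFree rfl (Q := fun m' =>
      m'.realReg 2 = 5 ∧ (∀ e < i + 1, m.realArr 4 e ≤ m.realReg 1) ∨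
      ∃ e < i + 1, m'.realReg 2 = m.realArr 4 e ∧ m.realReg 1 < m.realArr 4 e ∧
        ∀ e' < i + 1, m.realReg 1 < m.realArr 4 e' → m.realArr 4 e ≤ m.realArr 4 e') ?_).imp
        (by decide) fun _ _ h => h
    simp only [Program.run, Test.eval, RealExp.eval, IntExp.eval, e1, e4, h9]
    split_ifs with hc
    · refine Or.inr ⟨i, by omega, by simp, hc.1, fun e' he' hc' => ?_⟩
      by_cases hei : e' = i
      · rw [hei]
      · rcases h with ⟨-, h⟩ | ⟨e, he, h3, h4, h5⟩
        · exact absurd (h e' (by omega)) (not_le.2 hc')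
        · exact (h3 ▸ hc.2.le).trans (h5 e' (by omega) hc')
    · rw [not_and, not_lt] at hc
      rcases h with ⟨h3, h⟩ | ⟨e, he, h3, h4, h5⟩
      · refine Or.inl ⟨h3, fun e he => ?_⟩
        by_cases hei : e = i
        · by_contra! hlt
          rw [hei] at hlt
          have h6 := hc hlt
          have := hkey i hi
          linarith
        · exact h e (by omega)
      · refine Or.inr ⟨e, by omega, h3, h4, fun e' he' hc' => ?_⟩
        by_cases hei : e' = i
        · rw [hei] at hc' ⊢
          rw [← h3]
          exact hc hc'
        · exact h5 e' (by omega) hc'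
  · exact fun _ _ h => h
  · simp only [Program.bound, RealExp.cost]
    omega

/-- Records which robots meet at the links with the key in the real register `2`, and exchanges
them. -/
def exchange : Program :=
  forLoop 9 6 (.ite (.realEq (.arr 4 (.reg 9)) (.reg 2))
    (.storeInt 7 (.reg 9) (.arr 4 (.arr 5 (.reg 9))) ;;
      .storeInt 8 (.reg 9) (.arr 4 (.arr 6 (.reg 9))) ;;
      .storeInt 4 (.arr 5 (.reg 9)) (.arr 8 (.reg 9)) ;;
      .storeInt 4 (.arr 6 (.reg 9)) (.arr 7 (.reg 9))) .skip)

/-- Links with the current key have disjoint ends, so the swaps do not interfere and each reads the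
tokens from before the round. The recorded pair doubles as the temporary storage for its swap. -/
theorem runs_exchange {m : Mem} {E : ℕ} (hE : m.intReg 6 = E)
    (hne : ∀ e < E, m.intArr 5 e ≠ m.intArr 6 e)
    (hdisj : ∀ e < E, ∀ e' < E, m.realArr 4 e = m.realReg 2 → m.realArr 4 e' = m.realReg 2 →
      e ≠ e' → m.intArr 5 e ≠ m.intArr 5 e' ∧ m.intArr 5 e ≠ m.intArr 6 e' ∧
        m.intArr 6 e ≠ m.intArr 5 e' ∧ m.intArr 6 e ≠ m.intArr 6 e') :
    Runs exchange m (36 * E + 5) fun m' =>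
      (∀ e < E, m.realArr 4 e = m.realReg 2 →
        m'.intArr 7 e = m.intArr 4 (m.intArr 5 e) ∧ m'.intArr 8 e = m.intArr 4 (m.intArr 6 e) ∧
        m'.intArr 4 (m.intArr 5 e) = m.intArr 4 (m.intArr 6 e) ∧
        m'.intArr 4 (m.intArr 6 e) = m.intArr 4 (m.intArr 5 e)) ∧
      (∀ x, (∀ e < E, m.realArr 4 e = m.realReg 2 → x ≠ m.intArr 5 e ∧ x ≠ m.intArr 6 e) →
        m'.intArr 4 x = m.intArr 4 x) ∧
      ∀ e, m.realArr 4 e ≠ m.realReg 2 →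
        m'.intArr 7 e = m.intArr 7 e ∧ m'.intArr 8 e = m.intArr 8 e := by
  set eu := m.intArr 5 with heu
  set ev := m.intArr 6 with hev
  refine Runs.forLoop_uniform (N := E) (b := 29)
    rfl rfl rfl hE le_rfl (fun i m' =>
      (∀ e < i, m.realArr 4 e = m.realReg 2 →
        m'.intArr 7 e = m.intArr 4 (eu e) ∧ m'.intArr 8 e = m.intArr 4 (ev e) ∧
        m'.intArr 4 (eu e) = m.intArr 4 (ev e) ∧ m'.intArr 4 (ev e) = m.intArr 4 (eu e)) ∧
      (∀ x, (∀ e < i, m.realArr 4 e = m.realReg 2 → x ≠ eu e ∧ x ≠ ev e) →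
        m'.intArr 4 x = m.intArr 4 x) ∧
      ∀ e, m.realArr 4 e ≠ m.realReg 2 →
        m'.intArr 7 e = m.intArr 7 e ∧ m'.intArr 8 e = m.intArr 8 e) ?_ ?_ ?_ ?_
  · simp
  · simp
  · rintro i m' hi h9 hF ⟨h1, h2, h3⟩
    have e2 : m'.realReg 2 = m.realReg 2 := hF.3 2 rfl
    have e4 : m'.realArr 4 = m.realArr 4 := hF.4 4 rfl
    have e5 : m'.intArr 5 = eu := hF.2 5 rfl
    have e6 : m'.intArr 6 = ev := hF.2 6 rfl
    refine (Runs.of_loopFree rfl (Q := fun m' =>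
      (∀ e < i + 1, m.realArr 4 e = m.realReg 2 →
        m'.intArr 7 e = m.intArr 4 (eu e) ∧ m'.intArr 8 e = m.intArr 4 (ev e) ∧
        m'.intArr 4 (eu e) = m.intArr 4 (ev e) ∧ m'.intArr 4 (ev e) = m.intArr 4 (eu e)) ∧
      (∀ x, (∀ e < i + 1, m.realArr 4 e = m.realReg 2 → x ≠ eu e ∧ x ≠ ev e) →
        m'.intArr 4 x = m.intArr 4 x) ∧
      ∀ e, m.realArr 4 e ≠ m.realReg 2 →
        m'.intArr 7 e = m.intArr 7 e ∧ m'.intArr 8 e = m.intArr 8 e) ?_).imp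
        (by decide) fun _ _ h => h
    simp only [Program.run, Test.eval, RealExp.eval, IntExp.eval, e2, e4, e5, h9]
    split_ifs with hc
    · have hfree : ∀ e < i, m.realArr 4 e = m.realReg 2 →
          eu i ≠ eu e ∧ eu i ≠ ev e ∧ ev i ≠ eu e ∧ ev i ≠ ev e :=
        fun e he hce => hdisj i hi e (he.trans hi) hc hce (by omega)
      have hu : m'.intArr 4 (eu i) = m.intArr 4 (eu i) :=
        h2 _ fun e he hce => ⟨(hfree e he hce).1, (hfree e he hce).2.1⟩
      have hv : m'.intArr 4 (ev i) = m.intArr 4 (ev i) :=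
        h2 _ fun e he hce => (hfree e he hce).2.2
      have hi' := hne i hi
      simp [e5, e6, hu, hv]
      refine ⟨fun e he hce => ?_, fun x hx => ?_, fun e hce => ?_⟩
      · by_cases hei : e = i
        · subst hei
          simp [hi']
        · have hf := hfree e (by omega) hce
          simp [hei, hf.1.symm, hf.2.1.symm, hf.2.2.1.symm, hf.2.2.2.symm, h1 e (by omega) hce]
      · have hxi := hx i (by omega) hc
        simp [hxi.1, hxi.2]
        exact h2 x fun e he => hx e (by omega)
      · have hei : e ≠ i := fun h => hce (h ▸ hc)
        simp [hei, h3 e hce]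
    · refine ⟨fun e he hce => h1 e ?_ hce, fun x hx => h2 x fun e he => hx e (by omega), h3⟩
      have hei : e ≠ i := fun h => hc (h ▸ hce)
      omega
  · exact fun _ _ h => h

/-- The state of the simulation of one period after some rounds: all links with a key at most `cur`
were reached, the robot `tok x` is in the trajectory `x` when all robots follow their rings, and
the robots `ea e` and `eb e` meet at the link `e`. -/
structure Simulation {n : ℕ} (S : SCS n) (E : ℕ) (U V : ℕ → Fin n) (τ : ℕ → ℝ) (cur : ℝ)
    (tok ea eb : ℕ → ℕ) (t : ℝ) : Prop where
  nonneg : 0 ≤ t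
  le_one : t ≤ 1
  reached : ∀ e < E, timeKey (τ e) ≤ cur ↔ τ e < t
  tok_ring : ∀ u : Fin n, tok (S.ring u t) = u
  recorded : ∀ e < E, timeKey (τ e) ≤ cur → ∃ a b : Fin n, ea e = a ∧ eb e = b ∧
    S.ring a (τ e) = U e ∧ S.ring b (τ e) = V e

/-- No event occurs from `t` until `τ e₀`, so the rings stand still. At `τ e₀` each token at a link
crosses it, and the new clock `t'` is placed after `τ e₀` but not beyond the next event in the
period. -/
theorem Simulation.step {n : ℕ} {S : SCS n} {E : ℕ} {U V : ℕ → Fin n} {τ : ℕ → ℝ} {cur : ℝ}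
    {tok ea eb : ℕ → ℕ} {t : ℝ} (h : Simulation S E U V τ cur tok ea eb t)
    (hT : S.Timeline E U V τ) {e₀ : ℕ} (he₀ : e₀ < E) (hcur : cur < timeKey (τ e₀))
    (hmin : ∀ e < E, cur < timeKey (τ e) → timeKey (τ e₀) ≤ timeKey (τ e))
    {tok' ea' eb' : ℕ → ℕ}
    (h1 : ∀ e < E, timeKey (τ e) = timeKey (τ e₀) → ea' e = tok (U e) ∧ eb' e = tok (V e) ∧
      tok' (U e) = tok (V e) ∧ tok' (V e) = tok (U e))
    (h2 : ∀ x, (∀ e < E, timeKey (τ e) = timeKey (τ e₀) → x ≠ U e ∧ x ≠ V e) → tok' x = tok x)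
    (h3 : ∀ e < E, timeKey (τ e) ≠ timeKey (τ e₀) → ea' e = ea e ∧ eb' e = eb e) :
    ∃ t', Simulation S E U V τ (timeKey (τ e₀)) tok' ea' eb' t' := by
  have m₀ := hT.mem e₀ he₀
  have ht₀ : t ≤ τ e₀ := by
    by_contra! hlt
    exact absurd ((h.reached e₀ he₀).2 hlt) (not_le.2 hcur)
  have hring : ∀ u, S.ring u (τ e₀) = S.ring u t := by
    refine SCS.ring_eq_of_no_event h.nonneg ht₀ fun r hr hr' ⟨u, v, hm⟩ => ?_
    obtain ⟨e, he, rfl, -⟩ := hT.complete r ⟨h.nonneg.trans hr, hr'.trans m₀.2⟩ u v hm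
    have : cur < timeKey (τ e) := by
      by_contra! hle
      exact absurd ((h.reached e he).1 hle) (not_lt.2 hr)
    exact absurd (hmin e he this)
      (not_le.2 (timeKey_strictMonoOn (hT.mem e he) m₀ hr'))
  obtain ⟨t', ht1, ht2, hnext⟩ := SCS.exists_next_event (S := S) m₀.2
  have hcross : ∀ u, S.ring u t' = S.cross (S.ring u t) (τ e₀) := fun u => by
    rw [SCS.ring_eq_cross m₀.1 ht1 ⟨_, _, hT.meets e₀ he₀⟩
      (fun r hr hr' => hnext r (m₀.1.trans hr.le) hr hr'), hring]
  have htime : ∀ e < E, timeKey (τ e) = timeKey (τ e₀) ↔ τ e = τ e₀ := fun e he =>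
    timeKey_strictMonoOn.injOn.eq_iff (hT.mem e he) m₀
  refine ⟨t', m₀.1.trans ht1.le, ht2, fun e he => ?_, fun u => ?_, fun e he hle => ?_⟩
  · rw [timeKey_strictMonoOn.le_iff_le (hT.mem e he) m₀]
    refine ⟨fun hle => hle.trans_lt ht1, fun hlt => ?_⟩
    by_contra! hgt
    exact hnext _ (hT.mem e he).1 hgt hlt ⟨_, _, hT.meets e he⟩
  · rw [hcross]
    set x := S.ring u t with hx
    have hu : tok x = u := h.tok_ring u
    by_cases hm : ∃ y, S.Meets (τ e₀) x y
    · obtain ⟨y, hm⟩ := hm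
      rw [hm.cross_eq, ← hu]
      obtain ⟨e, he, hte, ⟨hU, hV⟩ | ⟨hU, hV⟩⟩ := hT.complete _ m₀ x y hm
      · have := (h1 e he ((htime e he).2 hte)).2.2.2
        rwa [hU, hV] at this
      · have := (h1 e he ((htime e he).2 hte)).2.2.1
        rwa [hU, hV] at this
    · push Not at hm
      rw [SCS.cross_eq_self hm, ← hu]
      refine h2 x fun e he hke => ?_
      have hme := hT.meets e he
      rw [(htime e he).1 hke] at hme
      exact ⟨fun hxe => hm (V e) (by rw [hxe]; exact hme),
        fun hxe => hm (U e) (by rw [hxe]; exact hme.symm)⟩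
  · by_cases hke : timeKey (τ e) = timeKey (τ e₀)
    · have hsurj : Function.Surjective fun u => S.ring u t :=
        Finite.injective_iff_surjective.1 (SCS.ring_injective t)
      obtain ⟨a, ha⟩ := hsurj (U e)
      obtain ⟨b, hb⟩ := hsurj (V e)
      simp only at ha hb
      obtain ⟨h4, h5, -⟩ := h1 e he hke
      refine ⟨a, b, ?_, ?_, ?_, ?_⟩
      · rw [h4, ← ha, h.tok_ring]
      · rw [h5, ← hb, h.tok_ring]
      · rw [(htime e he).1 hke, hring, ha]
      · rw [(htime e he).1 hke, hring, hb]
    · rw [(h3 e he hke).1, (h3 e he hke).2]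
      refine h.recorded e he ?_
      by_contra! hgt
      exact hke (le_antisymm hle (hmin e he hgt))

/-- Simulates one period. -/
def simulate : Program :=
  .setReal 1 (.const (-1)) ;; forLoop 8 6 (nextKey ;; exchange ;; .setReal 1 (.reg 2))

/-- Each round that finds a new key increases the number of processed links, so as many rounds as
there are links suffice. Simultaneous links are processed in one round, and the spare rounds change
no token or record. -/
theorem runs_simulate {n : ℕ} {S : SCS n} {m : Mem} {E : ℕ} {U V : ℕ → Fin n} {τ : ℕ → ℝ}
    (hT : S.Timeline E U V τ) (hE : m.intReg 6 = E)
    (hm : ∀ e < E, m.intArr 5 e = U e ∧ m.intArr 6 e = V e ∧ m.realArr 4 e = timeKey (τ e))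
    (htok : ∀ i < n, m.intArr 4 i = i) :
    Runs simulate m ((58 * E + 21) * E + 7) fun m' =>
      (∀ u : Fin n, m'.intArr 4 (S.ring u 1) = u) ∧
      ∀ e < E, ∃ a b : Fin n, m'.intArr 7 e = a ∧ m'.intArr 8 e = b ∧
        S.ring a (τ e) = U e ∧ S.ring b (τ e) = V e := by
  classical
  refine (Runs.seq (Runs.of_loopFree rfl (Q := fun m' => m'.realReg 1 = -1) (by
    simp [Program.run, RealExp.eval])) fun m1 hF1 hcur => Runs.forLoop_uniform (N := E)
    (b := 58 * E + 14)
    rfl rfl rfl ((hF1.1 6 rfl).trans hE) le_rfl (fun c m' =>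
      (∃ t, Simulation S E U V τ (m'.realReg 1) (m'.intArr 4) (m'.intArr 7) (m'.intArr 8) t) ∧
      c ≤ ((Finset.range E).filter fun e => timeKey (τ e) ≤ m'.realReg 1).card) ?_ ?_ ?_ ?_).imp ?_
      fun _ _ h => h
  -- The key `-1` lies below all keys, matching the fact that at clock 0 no link has been passed,
  -- not even one reached at time 0 itself.
  · refine ⟨⟨0, le_rfl, zero_le_one, fun e he => ?_, fun u => ?_, fun e he hle => ?_⟩, zero_le⟩
    · have h1 := timeKey_mem (hT.mem e he).1 (hT.mem e he).2
      have h2 := (hT.mem e he).1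
      rw [hcur]
      constructor <;> intro h <;> linarith [h1.1]
    · rw [SCS.ring_zero, hF1.2 4 rfl, htok u u.2]
    · have h1 := timeKey_mem (hT.mem e he).1 (hT.mem e he).2
      rw [hcur] at hle
      linarith [h1.1]
  · simp
  · rintro c m2 hc - hF2 ⟨⟨t, ht⟩, hcard⟩
    have hE2 : m2.intReg 6 = E := by rw [hF2.1 6 rfl, hF1.1 6 rfl, hE]
    have hm2 : ∀ e < E, m2.intArr 5 e = U e ∧ m2.intArr 6 e = V e ∧
        m2.realArr 4 e = timeKey (τ e) := fun e he => by
      rw [hF2.2 5 rfl, hF1.2 5 rfl, hF2.2 6 rfl, hF1.2 6 rfl, hF2.4 4 rfl, hF1.4 4 rfl]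
      exact hm e he
    have hlt5 : ∀ e < E, timeKey (τ e) < 5 := fun e he => by
      have := (timeKey_mem (hT.mem e he).1 (hT.mem e he).2).2
      linarith
    refine (Runs.seq (runs_nextKey hE2 fun e he => by rw [(hm2 e he).2.2]; exact hlt5 e he)
      fun m3 hF3 hbest => Runs.seq (runs_exchange (m := m3) (E := E) ((hF3.1 6 rfl).trans hE2)
        ?_ ?_)
      fun m4 hF4 hex => Runs.of_loopFree rfl (p := .setReal 1 (.reg 2)) ?_).imp (by
        simp only [Program.bound, RealExp.cost]; omega) fun _ _ h => h
    · intro e he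
      rw [hF3.2 5 rfl, hF3.2 6 rfl, (hm2 e he).1, (hm2 e he).2.1]
      exact fun h => (hT.meets e he).1.ne (Fin.ext h)
    · intro e he e' he' hk hk' hne
      rw [hF3.4 4 rfl, (hm2 _ he).2.2] at hk
      rw [hF3.4 4 rfl, (hm2 _ he').2.2] at hk'
      rw [hF3.2 5 rfl, hF3.2 6 rfl, (hm2 e he).1, (hm2 e he).2.1, (hm2 e' he').1, (hm2 e' he').2.1]
      have := hT.disjoint e he e' he'
        (timeKey_strictMonoOn.injOn (hT.mem e he) (hT.mem e' he') (hk.trans hk'.symm)) hne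
      simpa only [ne_eq, Fin.ext_iff] using this
    · have hk : ∀ e < E, m3.realArr 4 e = timeKey (τ e) := fun e he => by
        rw [hF3.4 4 rfl]; exact (hm2 e he).2.2
      have hu : ∀ e < E, m3.intArr 5 e = U e := fun e he => by
        rw [hF3.2 5 rfl]; exact (hm2 e he).1
      have hv : ∀ e < E, m3.intArr 6 e = V e := fun e he => by
        rw [hF3.2 6 rfl]; exact (hm2 e he).2.1
      obtain ⟨hx1, hx2, hx3⟩ := hex
      rw [hF3.2 4 rfl] at hx1 hx2
      rw [hF3.2 7 rfl, hF3.2 8 rfl] at hx3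
      have hr : Program.run (.setReal 1 (.reg 2)) m4 =
        { m4 with realReg := Function.update m4.realReg 1 (m3.realReg 2) } := by
        rw [← hF4.3 2 rfl]; rfl
      rw [hr]
      simp only [Function.update_self]
      rcases hbest with ⟨hb, hall⟩ | ⟨e₀, he₀, hb, hlt, hmin⟩
      -- All links are done: the current key becomes the sentinel 5, which matches no link, and the
      -- clock stays.
      · have hle : ∀ e < E, timeKey (τ e) ≤ m2.realReg 1 := fun e he => by
          rw [← (hm2 e he).2.2]; exact hall e he
        have hno : ∀ e < E, m3.realArr 4 e ≠ m3.realReg 2 := fun e he => by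
          rw [hb, hk e he]; exact (hlt5 e he).ne
        refine ⟨⟨t, ht.nonneg, ht.le_one, fun e he => ?_, fun u => ?_, fun e he _ => ?_⟩, ?_⟩
        · rw [hb, ← ht.reached e he]
          exact ⟨fun _ => hle e he, fun _ => (hlt5 e he).le⟩
        · rw [hx2 _ fun e he h => absurd h (hno e he), ht.tok_ring]
        · rw [(hx3 e (hno e he)).1, (hx3 e (hno e he)).2]
          exact ht.recorded e he (hle e he)
        · rw [Finset.filter_true_of_mem, Finset.card_range]
          · exact hc
          · intro e he
            rw [hb]
            exact (hlt5 e (Finset.mem_range.1 he)).le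
      · rw [(hm2 e₀ he₀).2.2] at hb hlt hmin
        rw [hb]
        have hmin' : ∀ e < E, m2.realReg 1 < timeKey (τ e) → timeKey (τ e₀) ≤ timeKey (τ e) :=
          fun e he h => by
            have := hmin e he
            rw [(hm2 e he).2.2] at this
            exact this h
        refine ⟨ht.step hT he₀ hlt hmin' (fun e he h => ?_) (fun x hx => ?_) (fun e he h => ?_), ?_⟩
        · have := hx1 e he (by rw [hk e he, hb, h])
          rwa [hu e he, hv e he] at this
        · refine hx2 x fun e he h => ?_
          rw [hu e he, hv e he]
          rw [hk e he, hb] at h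
          exact ⟨fun h' => (hx e he h).1 (Fin.ext h'), fun h' => (hx e he h).2 (Fin.ext h')⟩
        · exact hx3 e (by rw [hk e he, hb]; exact h)
        · refine hcard.trans_lt (Finset.card_lt_card ?_)
          rw [Finset.ssubset_iff_of_subset fun e he => by
            rw [Finset.mem_filter] at he ⊢; exact ⟨he.1, he.2.trans hlt.le⟩]
          refine ⟨e₀, Finset.mem_filter.2 ⟨Finset.mem_range.2 he₀, le_rfl⟩, fun h => ?_⟩
          exact absurd (Finset.mem_filter.1 h).2 (not_le.2 hlt)
  · rintro m' - ⟨⟨t, ht⟩, hcard⟩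
    have hall : ∀ e < E, timeKey (τ e) ≤ m'.realReg 1 := by
      have h1 := Finset.eq_of_subset_of_card_le (Finset.filter_subset _ _)
        ((Finset.card_range E).le.trans hcard)
      exact fun e he => (Finset.filter_eq_self.1 h1) e (Finset.mem_range.2 he)
    refine ⟨fun u => ?_, fun e he => ht.recorded e he (hall e he)⟩
    rw [SCS.ring_eq_of_no_event ht.nonneg ht.le_one, ht.tok_ring]
    rintro r hr hr1 ⟨u, v, hm⟩
    obtain ⟨e, he, rfl, -⟩ := hT.complete r ⟨ht.nonneg.trans hr, hr1⟩ u v hm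
    exact absurd ((ht.reached e he).1 (hall e he)) (not_lt.2 hr)
  · have : (58 * E + 14 + 7) * E = (58 * E + 21) * E := rfl
    simp only [Program.bound, RealExp.cost]
    omega

end RealRAM

/-! ### Meetings in later periods -/

namespace SCS

variable {n : ℕ} {S : SCS n} {σ : Fin n → Fin n}

theorem ring_apply_one (hσ : ∀ u, σ (S.ring u 1) = u) (u : Fin n) : S.ring (σ u) 1 = u := by
  obtain ⟨w, rfl⟩ := Finite.injective_iff_surjective.1 (ring_injective (S := S) 1) u
  simp only [hσ]

/-- After one period `σ u` and `σ v` are where `u` and `v` started, so they repeat every meeting of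
`u` and `v` one period later. -/
theorem meetingGraph_adj_map (hσ : ∀ u, σ (S.ring u 1) = u) {u v : Fin n}
    (h : S.meetingGraph.Adj u v) : S.meetingGraph.Adj (σ u) (σ v) := by
  obtain ⟨t, ht, hm⟩ := h
  refine ⟨t + 1, by linarith, ?_⟩
  rw [ring_add_one _ ht, ring_add_one _ ht, ring_apply_one hσ, ring_apply_one hσ]
  exact meets_add_one.2 hm

/-- A symmetric set of pairs that contains the meetings in the first period and is closed under
going back by one period contains all meetings. -/
theorem mem_of_meetingGraph_adj (hσ : ∀ u, σ (S.ring u 1) = u) {M : Set (Fin n × Fin n)}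
    (hM : ∀ u v, (u, v) ∈ M → (σ u, σ v) ∈ M)
    (hbase : ∀ s, 0 ≤ s → s < 1 → ∀ u v, S.Meets s (S.ring u s) (S.ring v s) → (u, v) ∈ M)
    {u v : Fin n} (h : S.meetingGraph.Adj u v) : (u, v) ∈ M := by
  obtain ⟨t, ht, hm⟩ := h
  have key : ∀ (N : ℕ) (s : ℝ), 0 ≤ s → s < 1 → ∀ u v,
      S.Meets (s + N) (S.ring u (s + N)) (S.ring v (s + N)) → (u, v) ∈ M := by
    intro N
    induction N with
    | zero => simpa using hbase
    | succ N ih =>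
      intro s h0 h1 u v h
      have h2 : 0 ≤ s + N := by positivity
      rw [show s + ((N + 1 : ℕ) : ℝ) = (s + N) + 1 by push_cast; ring, ring_add_one _ h2,
        ring_add_one _ h2, meets_add_one] at h
      have := hM _ _ (ih s h0 h1 _ _ h)
      rwa [hσ, hσ] at this
  refine key ⌊t⌋₊ (t - ⌊t⌋₊) (sub_nonneg.2 (Nat.floor_le ht)) ?_ u v ?_
  · linarith [Nat.lt_floor_add_one t]
  · rw [sub_add_cancel]
    exact hm

end SCS

/-! ### First phase: marking orbits of pairs -/

namespace RealRAM

/-- The integer array `2` is the indicator of the set `M` of pairs. -/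
def HoldsPairs {n : ℕ} (m : Mem) (M : Finset (Fin n × Fin n)) : Prop :=
  ∀ i j : Fin n, m.intArr 2 (i * n + j) = if (i, j) ∈ M then 1 else 0

/-- Marks the pair in the registers `10` and `11` and moves it back by one period. -/
def markStep : Program :=
  .storeInt 2 (.add (.arr 3 (.reg 10)) (.reg 11)) (.const 1) ;;
  .storeInt 2 (.add (.arr 3 (.reg 11)) (.reg 10)) (.const 1) ;;
  .setInt 10 (.arr 4 (.reg 10)) ;; .setInt 11 (.arr 4 (.reg 11))

/-- Marks the orbit of the pair in the registers `10` and `11`, up to the first marked pair. -/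
def markOrbit : Program :=
  .while (.intEq (.arr 2 (.add (.arr 3 (.reg 10)) (.reg 11))) (.const 0)) markStep

/-- Marks the orbits of all recorded pairs. -/
def markAll : Program :=
  forLoop 9 6 (.setInt 10 (.arr 7 (.reg 9)) ;; .setInt 11 (.arr 8 (.reg 9)) ;; markOrbit)

/-- The set `M` of pairs is symmetric, contained in `A`, and closed under `σ` except that the pair
`(x, y)` may be missing. -/
structure PartialOrbit {n : ℕ} (A : SimpleGraph (Fin n)) (σ : Fin n → Fin n)
    (M : Finset (Fin n × Fin n)) (x y : Fin n) : Prop where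
  sound : ∀ p q, (p, q) ∈ M → A.Adj p q
  symm : ∀ p q, (p, q) ∈ M → (q, p) ∈ M
  closed : ∀ p q, (p, q) ∈ M →
    (σ p, σ q) ∈ M ∨ (σ p, σ q) = (x, y) ∨ (σ p, σ q) = (y, x)

theorem PartialOrbit.insert {n : ℕ} {A : SimpleGraph (Fin n)} {σ : Fin n → Fin n}
    {M : Finset (Fin n × Fin n)} {x y : Fin n} (h : PartialOrbit A σ M x y) (hxy : A.Adj x y) :
    PartialOrbit A σ (insert (x, y) (insert (y, x) M)) (σ x) (σ y) where
  sound p q hpq := by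
    simp only [Finset.mem_insert, Prod.mk.injEq] at hpq
    rcases hpq with ⟨rfl, rfl⟩ | ⟨rfl, rfl⟩ | hpq
    exacts [hxy, hxy.symm, h.sound p q hpq]
  symm p q hpq := by
    simp only [Finset.mem_insert, Prod.mk.injEq] at hpq ⊢
    rcases hpq with ⟨rfl, rfl⟩ | ⟨rfl, rfl⟩ | hpq
    exacts [Or.inr (Or.inl ⟨rfl, rfl⟩), Or.inl ⟨rfl, rfl⟩, Or.inr (Or.inr (h.symm p q hpq))]
  closed p q hpq := by
    simp only [Finset.mem_insert] at hpq ⊢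
    rcases hpq with hpq | hpq | hpq
    · obtain ⟨rfl, rfl⟩ := Prod.mk.inj hpq
      exact Or.inr (Or.inl rfl)
    · obtain ⟨rfl, rfl⟩ := Prod.mk.inj hpq
      exact Or.inr (Or.inr rfl)
    · rcases h.closed p q hpq with h1 | h1 | h1
      exacts [Or.inl (Or.inr (Or.inr h1)), Or.inl (Or.inl h1), Or.inl (Or.inr (Or.inl h1))]

theorem run_markStep {n : ℕ} {σ : Fin n → Fin n} {m : Mem} {M : Finset (Fin n × Fin n)}
    {x y : Fin n} (hM : HoldsPairs m M)
    (htab : ∀ i < n, m.intArr 3 i = i * n) (hσ : ∀ i : Fin n, m.intArr 4 i = σ i)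
    (hx : m.intReg 10 = x) (hy : m.intReg 11 = y) :
    HoldsPairs (markStep.run m) (insert (x, y) (insert (y, x) M)) ∧
      (markStep.run m).intReg 10 = σ x ∧ (markStep.run m).intReg 11 = σ y := by
  refine ⟨fun i j => ?_, ?_, ?_⟩
  · have harr : (markStep.run m).intArr 2 =
        Function.update (Function.update (m.intArr 2) (x * n + y) 1) (y * n + x) 1 := by
      simp [markStep, Program.run, IntExp.eval, hx, hy, htab x x.2, htab y y.2]
    simp only [harr, Function.update_apply, index_inj, hM i j, Finset.mem_insert, Prod.mk.injEq]
    by_cases h1 : i = y ∧ j = x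
    · simp [h1]
    · by_cases h2 : i = x ∧ j = y <;> simp [h1, h2]
  · simp [markStep, Program.run, IntExp.eval, hx, hσ]
  · simp [markStep, Program.run, IntExp.eval, hy, hσ]

/-- The number of steps of `markOrbit` is amortized by the number of pairs that it marks. -/
theorem exec_markOrbit {n : ℕ} {A : SimpleGraph (Fin n)} {σ : Fin n → Fin n}
    (hA : ∀ u v, A.Adj u v → A.Adj (σ u) (σ v)) (d : ℕ) {m : Mem} {M : Finset (Fin n × Fin n)}
    {x y : Fin n} (hd : M.card + d = n * n) (hM : HoldsPairs m M)
    (htab : ∀ i < n, m.intArr 3 i = i * n) (hσ : ∀ i : Fin n, m.intArr 4 i = σ i)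
    (hx : m.intReg 10 = x) (hy : m.intReg 11 = y) (hxy : A.Adj x y) (h : PartialOrbit A σ M x y) :
    ∃ m' T M', Exec markOrbit m m' T ∧
      T + (markStep.bound + 7) * M.card ≤ (markStep.bound + 7) * M'.card + 7 ∧
      HoldsPairs m' M' ∧ M ⊆ M' ∧ (x, y) ∈ M' ∧ (∀ p q, (p, q) ∈ M' → A.Adj p q) ∧
      (∀ p q, (p, q) ∈ M' → (q, p) ∈ M') ∧ ∀ p q, (p, q) ∈ M' → (σ p, σ q) ∈ M' := by
  classical
  induction d using Nat.strong_induction_on generalizing m M x y with | _ d ih => ?_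
  -- The induction is on the number `d` of unmarked pairs.
  have htest : (Test.intEq (.arr 2 (.add (.arr 3 (.reg 10)) (.reg 11))) (.const 0)).eval m ↔
      (x, y) ∉ M := by
    simp [Test.eval, IntExp.eval, hx, hy, htab x x.2, hM x y]
  by_cases hmem : (x, y) ∈ M
  -- The pair `(x, y)` was the only possible gap in the closure under `σ`, up to symmetry. As it is
  -- already marked, the rest of its orbit is marked too, and stopping is safe.
  · refine ⟨m, _, M, Exec.whileFalse _ _ _ (by simpa [htest] using hmem), ?_, hM, subset_rfl, hmem,
      h.sound, h.symm, fun p q hpq => ?_⟩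
    · simp only [Test.cost, IntExp.cost]
      omega
    · rcases h.closed p q hpq with h1 | h1 | h1
      · exact h1
      · rwa [h1]
      · rw [h1]
        exact h.symm _ _ hmem
  · have hlt : M.card < n * n := by
      have := Finset.card_lt_univ_of_notMem hmem
      simpa using this
    obtain ⟨T₁, hex, hT₁⟩ := Program.exec_run (p := markStep) rfl m
    set m₁ := markStep.run m with hm₁
    set M₁ := insert (x, y) (insert (y, x) M) with hM₁
    have hF := hex.frame
    -- The pair `(x, y)` is new, and it pays for this pass through the loop.
    have hcard : M.card + 1 ≤ M₁.card := by
      rw [← Finset.card_insert_of_notMem hmem]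
      refine Finset.card_le_card fun p hp => ?_
      simp only [hM₁, Finset.mem_insert] at hp ⊢
      tauto
    have hcard' : M₁.card ≤ n * n := by
      have := Finset.card_le_univ M₁
      simpa using this
    obtain ⟨hpairs, h10, h11⟩ := run_markStep hM htab hσ hx hy
    obtain ⟨m', T, M', he', hT', hM', hsub, -, h1, h2, h3⟩ :=
      ih (n * n - M₁.card) (by omega) (M := M₁) (x := σ x) (y := σ y)
        (by omega) hpairs
        (fun i hi => (congrFun (hF.2 3 rfl) i).trans (htab i hi))
        (fun i => (congrFun (hF.2 4 rfl) i).trans (hσ i)) h10 h11 (hA x y hxy)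
        (h.insert hxy)
    refine ⟨m', _, M', Exec.whileTrue _ _ _ _ _ _ _ (htest.2 hmem) hex he', ?_, hM',
      fun p hp => hsub ?_, hsub ?_, h1, h2, h3⟩
    · have := Nat.mul_le_mul_left (markStep.bound + 7) hcard
      rw [mul_add_one] at this
      simp only [Test.cost, IntExp.cost]
      omega
    · simp only [hM₁, Finset.mem_insert]
      exact Or.inr (Or.inr hp)
    · simp [hM₁]

/-- A single orbit may be long, so a uniform bound for the loop body would be too weak. The
accumulated time is charged to the marked pairs, at most `n * n`, plus 13 steps per link for loading
the pair and the failing test. -/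
theorem runs_markAll {n : ℕ} {A : SimpleGraph (Fin n)} {σ : Fin n → Fin n} {m : Mem} {E : ℕ}
    {a b : ℕ → Fin n} (hA : ∀ u v, A.Adj u v → A.Adj (σ u) (σ v)) (hE : m.intReg 6 = E)
    (htab : ∀ i < n, m.intArr 3 i = i * n) (hσ : ∀ i : Fin n, m.intArr 4 i = σ i)
    (ha : ∀ e < E, m.intArr 7 e = a e) (hb : ∀ e < E, m.intArr 8 e = b e)
    (hab : ∀ e < E, A.Adj (a e) (b e)) (h2 : HoldsPairs m (∅ : Finset (Fin n × Fin n))) :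
    Runs markAll m ((markStep.bound + 7) * (n * n) + 13 * E + 7 * E + 5) fun m' =>
      ∃ M : Finset (Fin n × Fin n), HoldsPairs m' M ∧ (∀ p q, (p, q) ∈ M → A.Adj p q) ∧
        (∀ p q, (p, q) ∈ M → (q, p) ∈ M) ∧ (∀ p q, (p, q) ∈ M → (σ p, σ q) ∈ M) ∧
        ∀ e < E, (a e, b e) ∈ M := by
  have := Runs.forLoop (x := 9) (y := 6) (B := (markStep.bound + 7) * (n * n) + 13 * E) (m := m)
    (p := .setInt 10 (.arr 7 (.reg 9)) ;; .setInt 11 (.arr 8 (.reg 9)) ;; markOrbit) rfl rfl rfl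
    (fun i t m' => ∃ M : Finset (Fin n × Fin n), HoldsPairs m' M ∧
      (∀ p q, (p, q) ∈ M → A.Adj p q) ∧ (∀ p q, (p, q) ∈ M → (q, p) ∈ M) ∧
      (∀ p q, (p, q) ∈ M → (σ p, σ q) ∈ M) ∧ (∀ e < i, (a e, b e) ∈ M) ∧
      t ≤ (markStep.bound + 7) * M.card + 13 * i) ?_ ?_ ?_ ?_
  · rw [hE] at this
    exact this.imp (by omega) fun m' _ ⟨t, M, h1, h2, h3, h4, h5, _⟩ => ⟨M, h1, h2, h3, h4, h5⟩
  · exact ⟨∅, h2, by simp⟩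
  · exact fun i t m' v h => h
  · rintro i t m' hi h9 hF ⟨M, h1, h2, h3, h4, h5, h6⟩
    rw [hE] at hi
    have hex : Exec (.setInt 10 (.arr 7 (.reg 9))) m' _ _ := Exec.setInt _ _ _
    set m₁ : Mem := { m' with
      intReg := Function.update m'.intReg 10 (IntExp.eval m' (.arr 7 (.reg 9))) } with hm₁
    have hex₁ : Exec (.setInt 11 (.arr 8 (.reg 9))) m₁ _ _ := Exec.setInt _ _ _
    set m₂ : Mem := { m₁ with
      intReg := Function.update m₁.intReg 11 (IntExp.eval m₁ (.arr 8 (.reg 9))) } with hm₂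
    have e7 : m'.intArr 7 = m.intArr 7 := hF.2 7 rfl
    have e8 : m'.intArr 8 = m.intArr 8 := hF.2 8 rfl
    have hcard : M.card ≤ n * n := by
      have := Finset.card_le_univ M
      simpa using this
    obtain ⟨m₃, T, M', he, hT, h1', hsub, hmem, h2', h3', h4'⟩ :=
      exec_markOrbit hA (n * n - M.card) (m := m₂) (M := M) (x := a i) (y := b i)
      (by omega) h1 (fun i hi => (congrFun (hF.2 3 rfl) i).trans (htab i hi))
      (fun i => (congrFun (hF.2 4 rfl) i).trans (hσ i))
      (by simp [hm₂, hm₁, IntExp.eval, h9, e7, ha i hi])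
      (by simp [hm₂, hm₁, IntExp.eval, h9, e8, hb i hi]) (hab i hi)
      ⟨h2, h3, fun p q hpq => Or.inl (h4 p q hpq)⟩
    refine ⟨_, m₃, _, .seq _ _ _ _ _ _ _ hex (.seq _ _ _ _ _ _ _ hex₁ he), le_rfl, M', h1', h2',
      h3', h4', fun e he => ?_, ?_⟩
    · by_cases hei : e = i
      · rwa [hei]
      · exact hsub (h5 e (by omega))
    · simp only [IntExp.cost]
      omega
  · rintro t m' ⟨M, -, -, -, -, -, h⟩
    have hcard : M.card ≤ n * n := by
      have := Finset.card_le_univ M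
      simpa using this
    rw [hE] at h
    have := Nat.mul_le_mul_left (markStep.bound + 7) hcard
    omega

/-- Computes the meeting graph. -/
def meetingProgram : Program := initTables ;; listEdges ;; simulate ;; markAll

/-- The last clauses preserve what the second phase relies on: the size, `k`, the row offsets, and
the still untouched zero array `9`, which is its first tuple. -/
theorem runs_meetingProgram : ∃ C : ℕ, ∀ (n : ℕ) (S : SCS n) (k : ℕ),
    Runs meetingProgram (input S k) (C * n ^ 2) fun m =>
      HoldsGraph m S.meetingGraph ∧ m.intReg 0 = n ∧ m.intReg 1 = k ∧
        (∀ i < n, m.intArr 3 i = i * n) ∧ ∀ i, m.intArr 9 i = 0 := by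
  classical
  set c := tryEdge.bound
  set c' := markStep.bound
  refine ⟨(24 + 10) + ((c + 7 + 5 + 7) + 7) + ((58 * 36 + 21) * 36 + 7) +
    ((c' + 7) + 20 * 36 + 5), fun n S k => ?_⟩
  have hn : 1 ≤ n := Fin.pos_iff_nonempty.2 S.connected.nonempty
  have hS := holdsSystem_input S k
  refine (Runs.seq (runs_initTables (n := n) hS.size) fun m₁ hF₁ htab =>
    Runs.seq (B' := ((58 * (36 * n) + 21) * (36 * n) + 7) +
      ((c' + 7) * (n * n) + 20 * (36 * n) + 5))
      (runs_listEdges (hS.frame hF₁ rfl rfl rfl rfl rfl rfl rfl) fun i hi => (htab i hi).1)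
    fun m₂ hF₂ hE => ?_).imp ?_ fun _ _ h => h
  · have hEn := hE.card_le
    obtain ⟨U, V, τ, hT, hUV⟩ := hE.exists_timeline
    refine Runs.seq ((runs_simulate hT rfl hUV fun i hi => by
      rw [hF₂.2 4 rfl]; exact (htab i hi).2).imp (by gcongr) fun _ _ h => h)
      fun m₃ hF₃ ⟨htok, hrec⟩ => ?_
    have hne : Nonempty (Fin n) := S.connected.nonempty
    have hσ : ∀ i : Fin n, ∃ u : Fin n, m₃.intArr 4 i = u := fun i => by
      obtain ⟨u, rfl⟩ := Finite.injective_iff_surjective.1 (SCS.ring_injective (S := S) 1) i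
      exact ⟨u, htok u⟩
    choose σ hσ using hσ
    have hσ' : ∀ u, σ (S.ring u 1) = u := fun u => Fin.ext ((hσ _).symm.trans (htok u))
    have hrec' : ∀ e, ∃ a b : Fin n, e < m₂.intReg 6 → m₃.intArr 7 e = a ∧ m₃.intArr 8 e = b ∧
        S.ring a (τ e) = U e ∧ S.ring b (τ e) = V e := fun e => by
      by_cases he : e < m₂.intReg 6
      · obtain ⟨a, b, h⟩ := hrec e he
        exact ⟨a, b, fun _ => h⟩
      · exact ⟨hne.some, hne.some, fun h => absurd h he⟩
    choose a b hab using hrec'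
    have htab₃ : ∀ i < n, m₃.intArr 3 i = i * n := fun i hi => by
      rw [hF₃.2 3 rfl, hF₂.2 3 rfl]; exact (htab i hi).1
    refine (runs_markAll (A := S.meetingGraph) (E := m₂.intReg 6)
      (fun u v => SCS.meetingGraph_adj_map hσ') (hF₃.1 6 rfl) htab₃ hσ
      (fun e he => (hab e he).1) (fun e he => (hab e he).2.1) ?_ ?_).imp (by
        have : (c' + 7) * (n * n) + 13 * m₂.intReg 6 + 7 * m₂.intReg 6 + 5 =
          (c' + 7) * (n * n) + 20 * m₂.intReg 6 + 5 := by ring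
        rw [this]
        gcongr) ?_
    · intro e he
      have hm := hT.meets e he
      rw [← (hab e he).2.2.1, ← (hab e he).2.2.2] at hm
      exact ⟨τ e, (hT.mem e he).1, hm⟩
    · intro i j
      rw [hF₃.2 2 rfl, hF₂.2 2 rfl, hF₁.2 2 rfl]
      simp [input]
    · rintro m₄ hF₄ ⟨M, hM, hsound, hsymm, hclosed, hbase⟩
      refine ⟨fun i j => ?_, ?_, ?_, ?_, ?_⟩
      · rw [hM i j]
        have : (i, j) ∈ M ↔ S.meetingGraph.Adj i j := by
          refine ⟨hsound i j, fun h => ?_⟩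
          refine SCS.mem_of_meetingGraph_adj (M := (M : Set (Fin n × Fin n))) hσ'
            hclosed (fun s h0 h1 u v hm => ?_) h
          obtain ⟨e, he, rfl, hUV⟩ := hT.complete s ⟨h0, h1⟩ _ _ hm
          have hinj := SCS.ring_injective (S := S) (τ e)
          rcases hUV with ⟨hu, hv⟩ | ⟨hv, hu⟩
          · have h3 : a e = u := hinj ((hab e he).2.2.1.trans hu)
            have h4 : b e = v := hinj ((hab e he).2.2.2.trans hv)
            exact h3 ▸ h4 ▸ hbase e he
          · have h3 : a e = v := hinj ((hab e he).2.2.1.trans hv)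
            have h4 : b e = u := hinj ((hab e he).2.2.2.trans hu)
            exact h3 ▸ h4 ▸ hsymm _ _ (hbase e he)
        simp only [this]
      · rw [hF₄.1 0 rfl, hF₃.1 0 rfl, hF₂.1 0 rfl, hF₁.1 0 rfl, hS.size]
      · rw [hF₄.1 1 rfl, hF₃.1 1 rfl, hF₂.1 1 rfl, hF₁.1 1 rfl]
        simp [input]
      · intro i hi
        rw [hF₄.2 3 rfl, htab₃ i hi]
      · intro i
        rw [hF₄.2 9 rfl, hF₃.2 9 rfl, hF₂.2 9 rfl, hF₁.2 9 rfl]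
        simp [input]
  · have h1 : n ≤ n * n := Nat.le_mul_of_pos_left _ hn
    have h2 : c * n ≤ c * (n * n) := Nat.mul_le_mul_left _ h1
    have h3 : c' * n ≤ c' * (n * n) := Nat.mul_le_mul_left _ h1
    nlinarith

/-! ### Second phase: evaluating the tuples -/

/-- Puts `n ^ k` into the register `13`. -/
def countTuples : Program :=
  .setInt 13 (.const 1) ;; forLoop 4 1 (.setInt 14 (.const 0) ;;
    forLoop 7 0 (.setInt 14 (.add (.reg 14) (.reg 13))) ;; .setInt 13 (.reg 14))

theorem runs_countTuples {m : Mem} {n k : ℕ} (hn : m.intReg 0 = n) (hk : m.intReg 1 = k) :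
    Runs countTuples m ((11 * n + 16) * k + 7) fun m' => m'.intReg 13 = n ^ k := by
  refine (Runs.seq (Runs.of_loopFree rfl (Q := fun m' => m'.intReg 13 = 1) (by
    simp [Program.run, IntExp.eval])) fun m₁ hF₁ h13 => Runs.forLoop_uniform (b := 11 * n + 9)
    rfl rfl rfl ((hF₁.1 1 rfl).trans hk) le_rfl (fun i m' => m'.intReg 13 = n ^ i)
    (by simpa using h13) (by simp) ?_ fun _ _ h => h).imp ?_ fun _ _ h => h
  · intro i m₂ hi h4 hF₂ h
    refine (Runs.seq (Runs.of_loopFree rfl (Q := fun m' => m'.intReg 14 = 0) (by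
      simp [Program.run, IntExp.eval])) fun m₃ hF₃ h14 => Runs.seq
      (Runs.forLoop_uniform (b := 4) (N := n) (B := 11 * n + 5) rfl rfl rfl ?_ (by omega)
        (fun j m' => m'.intReg 14 = j * n ^ i) (by simpa using h14) (by simp) ?_
        (Q := fun m' => m'.intReg 14 = n * n ^ i) fun _ _ h => h)
      fun m₄ hF₄ h' => Runs.of_loopFree rfl ?_).imp ?_ fun _ _ h => h
    · rw [hF₃.1 0 rfl, hF₂.1 0 rfl, hF₁.1 0 rfl, hn]
    · intro j m₅ _ _ hF₅ h'
      refine Runs.of_loopFree rfl ?_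
      have : m₅.intReg 13 = n ^ i := by rw [hF₅.1 13 rfl, hF₃.1 13 rfl, h]
      simp [Program.run, IntExp.eval, h', this, add_mul]
    · simp [Program.run, IntExp.eval, h', pow_succ']
    · simp only [Program.bound, IntExp.cost]
      omega
  · have : (11 * n + 9 + 7) * k = (11 * n + 16) * k := rfl
    simp only [Program.bound, IntExp.cost]
    omega

theorem lt_succ_iff_lt_or_eq {k i : ℕ} (hi : i < k) (b : Fin k) :
    (b : ℕ) < i + 1 ↔ (b : ℕ) < i ∨ b = ⟨i, hi⟩ := by
  have : b = ⟨i, hi⟩ ↔ (b : ℕ) = i := Fin.ext_iff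
  rw [this]
  omega

theorem card_filter_lt_succ {k i : ℕ} (hi : i < k) (p : Fin k → Prop) [DecidablePred p] :
    (Finset.univ.filter fun a : Fin k => (a : ℕ) < i + 1 ∧ p a).card =
      (Finset.univ.filter fun a : Fin k => (a : ℕ) < i ∧ p a).card +
        if p ⟨i, hi⟩ then 1 else 0 := by
  split_ifs with h
  · rw [← Finset.card_insert_of_notMem (a := ⟨i, hi⟩) (by simp)]
    congr 1
    ext b
    simp only [Finset.mem_filter, Finset.mem_univ, true_and, Finset.mem_insert,
      lt_succ_iff_lt_or_eq hi]
    constructor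
    · rintro ⟨hb | hb, hb'⟩
      exacts [Or.inr ⟨hb, hb'⟩, Or.inl hb]
    · rintro (hb | ⟨hb, hb'⟩)
      exacts [⟨Or.inr hb, hb ▸ h⟩, ⟨Or.inl hb, hb'⟩]
  · rw [add_zero]
    congr 1
    ext b
    simp only [Finset.mem_filter, Finset.mem_univ, true_and, lt_succ_iff_lt_or_eq hi]
    constructor
    · rintro ⟨hb | hb, hb'⟩
      exacts [⟨hb, hb'⟩, absurd (hb ▸ hb') h]
    · exact fun ⟨hb, hb'⟩ => ⟨Or.inl hb, hb'⟩

theorem exists_lt_succ {k i : ℕ} (hi : i < k) (p : Fin k → Prop) :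
    (∃ b : Fin k, (b : ℕ) < i + 1 ∧ p b) ↔ (∃ b : Fin k, (b : ℕ) < i ∧ p b) ∨ p ⟨i, hi⟩ := by
  simp only [lt_succ_iff_lt_or_eq hi, or_and_right, exists_or, exists_eq_left]

theorem forall_lt_succ {k i : ℕ} (hi : i < k) (p : Fin k → Prop) :
    (∀ b : Fin k, (b : ℕ) < i + 1 → p b) ↔ (∀ b : Fin k, (b : ℕ) < i → p b) ∧ p ⟨i, hi⟩ := by
  simp only [lt_succ_iff_lt_or_eq hi, or_imp, forall_and, forall_eq]

/-- Counts in the register `17` the occurrences of the vertex in the register `4` in the tuple in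
the array `9`, and tests whether it has a neighbour in the tuple, with the result in the register
`18`. -/
def scanTuple : Program :=
  .setInt 17 (.const 0) ;; .setInt 18 (.const 0) ;; forLoop 7 1
    (.ite (.intEq (.arr 9 (.reg 7)) (.reg 4)) (.setInt 17 (.add (.reg 17) (.const 1))) .skip ;;
      .ite (.intEq (.arr 2 (.add (.arr 3 (.arr 9 (.reg 7))) (.reg 4))) (.const 1))
        (.setInt 18 (.const 1)) .skip)

theorem runs_scanTuple {n k : ℕ} {m : Mem} {H : SimpleGraph (Fin n)} {d : Fin k → Fin n}
    {v : Fin n} (hk : m.intReg 1 = k) (hv : m.intReg 4 = v) (hG : HoldsGraph m H)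
    (htab : ∀ i < n, m.intArr 3 i = i * n) (hd : ∀ a : Fin k, m.intArr 9 a = d a) :
    Runs scanTuple m (35 * k + 9) fun m' =>
      (0 < m'.intReg 17 ↔ ∃ a, d a = v) ∧
      (1 < m'.intReg 17 ↔ ∃ a b, a ≠ b ∧ d a = v ∧ d b = v) ∧
      (m'.intReg 18 = 1 ↔ ∃ a, H.Adj (d a) v) := by
  classical
  let A : ℕ → Finset (Fin k) := fun i => Finset.univ.filter fun a => (a : ℕ) < i ∧ d a = v
  refine (Runs.seq (Runs.of_loopFree rfl (Q := fun m' => m'.intReg 17 = 0) (by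
    simp [Program.run, IntExp.eval])) fun m₁ hF₁ h17 =>
    Runs.seq (Runs.of_loopFree rfl (Q := fun m' => m'.intReg 18 = 0) (by
    simp [Program.run, IntExp.eval])) fun m₂ hF₂ h18 => Runs.forLoop_uniform (b := 28)
    (N := k) rfl rfl rfl ?_ le_rfl (fun i m' => m'.intReg 17 = (A i).card ∧
      (m'.intReg 18 = 1 ↔ ∃ a : Fin k, (a : ℕ) < i ∧ H.Adj (d a) v)) ?_ ?_ ?_ ?_).imp ?_
      fun _ _ h => h
  · rw [hF₂.1 1 rfl, hF₁.1 1 rfl, hk]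
  · refine ⟨?_, by simp [h18]⟩
    rw [hF₂.1 17 rfl, h17]
    simp [A]
  · simp
  · rintro i m₃ hi h7 hF₃ ⟨h1, h2⟩
    let a : Fin k := ⟨i, hi⟩
    have e4 : m₃.intReg 4 = v := by rw [hF₃.1 4 rfl, hF₂.1 4 rfl, hF₁.1 4 rfl, hv]
    have e9 : m₃.intArr 9 i = d a := by rw [hF₃.2 9 rfl, hF₂.2 9 rfl, hF₁.2 9 rfl, ← hd a]
    have t1 : m₃.intArr 9 i = m₃.intReg 4 ↔ d a = v := by rw [e9, e4, Fin.ext_iff]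
    have t2 : m₃.intArr 2 (m₃.intArr 3 (m₃.intArr 9 i) + m₃.intReg 4) = 1 ↔ H.Adj (d a) v := by
      rw [e9, e4, hF₃.2 3 rfl, hF₂.2 3 rfl, hF₁.2 3 rfl, htab _ (d a).2, hF₃.2 2 rfl,
        hF₂.2 2 rfl, hF₁.2 2 rfl, hG (d a) v]
      simp
    have hA : (A (i + 1)).card = (A i).card + if d a = v then 1 else 0 :=
      card_filter_lt_succ hi fun b => d b = v
    refine (Runs.of_loopFree rfl ?_).imp (Q := fun m' => m'.intReg 17 = (A (i + 1)).card ∧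
      (m'.intReg 18 = 1 ↔ ∃ a : Fin k, (a : ℕ) < i + 1 ∧ H.Adj (d a) v)) (by decide)
      fun _ _ h => h
    rw [hA, exists_lt_succ hi, ← h1, ← h2]
    change _ ∧ (_ ↔ _ ∨ H.Adj (d a) v)
    rcases Classical.propComplete (d a = v) with c1 | c1 <;>
      rcases Classical.propComplete (H.Adj (d a) v) with c2 | c2 <;>
      simp [Program.run, Test.eval, IntExp.eval, h7, t1, t2, c1, c2]
  · rintro m' - ⟨h1, h2⟩
    have hAk : A k = Finset.univ.filter fun a => d a = v := by simp [A]
    rw [hAk] at h1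
    rw [h1, h2]
    refine ⟨?_, ?_, by simp⟩
    · rw [Finset.card_pos]
      simp [Finset.Nonempty]
    · rw [Finset.one_lt_card]
      simp only [Finset.mem_filter, Finset.mem_univ, true_and]
      constructor
      · rintro ⟨a, ha, b, hb, hab⟩
        exact ⟨a, b, hab, ha, hb⟩
      · rintro ⟨a, b, hab, ha, hb⟩
        exact ⟨a, ha, b, hb, hab⟩
  · simp only [Program.bound, IntExp.cost]
    omega

/-- Puts into the register `15` the number of neighbours of the vertices of the tuple in the array
`9`, and `0` into the register `16` if these vertices are distinct and pairwise nonadjacent. -/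
def evaluateTuple : Program :=
  .setInt 15 (.const 0) ;; .setInt 16 (.const 0) ;; forLoop 4 0 (scanTuple ;;
    .ite (.intEq (.reg 18) (.const 1)) (.setInt 15 (.add (.reg 15) (.const 1)) ;;
      .ite (.intLt (.const 0) (.reg 17)) (.setInt 16 (.const 1)) .skip) .skip ;;
    .ite (.intLt (.const 1) (.reg 17)) (.setInt 16 (.const 1)) .skip)

theorem runs_evaluateTuple {n k : ℕ} {m : Mem} {H : SimpleGraph (Fin n)} {d : Fin k → Fin n}
    (hn : m.intReg 0 = n) (hk : m.intReg 1 = k) (hG : HoldsGraph m H)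
    (htab : ∀ i < n, m.intArr 3 i = i * n) (hd : ∀ a : Fin k, m.intArr 9 a = d a) :
    Runs evaluateTuple m ((35 * k + 36) * n + 9) fun m' =>
      (if m'.intReg 16 = 0 then (m'.intReg 15 : ℕ∞) else ⊤) = H.tupleCost d := by
  classical
  let A : ℕ → Finset (Fin n) := fun i =>
    Finset.univ.filter fun v => (v : ℕ) < i ∧ ∃ a, H.Adj (d a) v
  -- Distinctness and independence are both tested one vertex at a time: no vertex may occur twice
  -- in the tuple, and none may both occur in it and have a neighbour in it. One scan of the tuple
  -- per vertex thus decides both and counts the neighbours.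
  let good : Fin n → Prop := fun v =>
    ¬ (∃ a b, a ≠ b ∧ d a = v ∧ d b = v) ∧ ¬ ((∃ a, H.Adj (d a) v) ∧ ∃ a, d a = v)
  refine (Runs.seq (Runs.of_loopFree rfl (Q := fun m' => m'.intReg 15 = 0) (by
    simp [Program.run, IntExp.eval])) fun m₁ hF₁ h15 =>
    Runs.seq (Runs.of_loopFree rfl (Q := fun m' => m'.intReg 16 = 0) (by
    simp [Program.run, IntExp.eval])) fun m₂ hF₂ h16 => Runs.forLoop_uniform (b := 35 * k + 29)
    (N := n) rfl rfl rfl ?_ le_rfl (fun i m' => m'.intReg 15 = (A i).card ∧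
      (m'.intReg 16 = 0 ↔ ∀ v : Fin n, (v : ℕ) < i → good v)) ?_ ?_ ?_ ?_).imp ?_
      fun _ _ h => h
  · rw [hF₂.1 0 rfl, hF₁.1 0 rfl, hn]
  · refine ⟨?_, by simp [h16]⟩
    rw [hF₂.1 15 rfl, h15]
    simp [A]
  · simp
  · rintro i m₃ hi h4 hF₃ ⟨h1, h2⟩
    have hG₃ : HoldsGraph m₃ H := fun u v => by
      rw [hF₃.2 2 rfl, hF₂.2 2 rfl, hF₁.2 2 rfl, hG u v]
    let v : Fin n := ⟨i, hi⟩
    refine (Runs.seq (runs_scanTuple (v := v) (d := d) ?_ h4 hG₃ (fun i hi => ?_) fun a => ?_)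
      fun m₄ hF₄ ⟨s1, s2, s3⟩ => Runs.of_loopFree rfl (Q := fun m' => m'.intReg 15 =
        (A (i + 1)).card ∧ (m'.intReg 16 = 0 ↔ ∀ v : Fin n, (v : ℕ) < i + 1 → good v)) ?_).imp
        ?_ fun _ _ h => h
    · rw [hF₃.1 1 rfl, hF₂.1 1 rfl, hF₁.1 1 rfl, hk]
    · rw [hF₃.2 3 rfl, hF₂.2 3 rfl, hF₁.2 3 rfl, htab i hi]
    · rw [hF₃.2 9 rfl, hF₂.2 9 rfl, hF₁.2 9 rfl, hd]
    · have hA : (A (i + 1)).card = (A i).card + if ∃ a, H.Adj (d a) v then 1 else 0 :=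
        card_filter_lt_succ hi fun v => ∃ a, H.Adj (d a) v
      have hgood : good v ↔ ¬ 1 < m₄.intReg 17 ∧ ¬ (m₄.intReg 18 = 1 ∧ 0 < m₄.intReg 17) := by
        rw [s1, s2, s3]
      rw [hA, forall_lt_succ hi, ← h1, ← h2, ← hF₄.1 15 rfl, ← hF₄.1 16 rfl]
      simp only [← s3]
      change _ ∧ (_ ↔ _ ∧ good v)
      rw [hgood]
      by_cases c1 : m₄.intReg 18 = 1 <;> by_cases c2 : 0 < m₄.intReg 17 <;>
        by_cases c3 : 1 < m₄.intReg 17 <;>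
        simp [Program.run, Test.eval, IntExp.eval, c1, c2, c3]
    · simp only [Program.bound, IntExp.cost, Test.cost]
      omega
  · rintro m' - ⟨h1, h2⟩
    have hAn : A n = Finset.univ.filter fun v => ∃ a, H.Adj (d a) v := by simp [A]
    have hall : (∀ v : Fin n, (v : ℕ) < n → good v) ↔
        Function.Injective d ∧ ∀ a b, ¬ H.Adj (d a) (d b) := by
      constructor
      · refine fun h => ⟨fun a b hab => ?_, fun a b hadj => ?_⟩
        · by_contra hne
          exact (h (d b) (d b).2).1 ⟨a, b, hne, hab, rfl⟩
        · exact (h (d b) (d b).2).2 ⟨⟨a, hadj⟩, b, rfl⟩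
      · rintro ⟨hinj, hind⟩ v -
        refine ⟨?_, ?_⟩
        · rintro ⟨a, b, hne, ha, hb⟩
          exact hne (hinj (ha.trans hb.symm))
        · rintro ⟨⟨a, hadj⟩, b, rfl⟩
          exact hind a b hadj
    rw [hAn] at h1
    rw [hall] at h2
    unfold SimpleGraph.tupleCost
    simp only [h1, h2]
  · have : (35 * k + 29 + 7) * n = (35 * k + 36) * n := rfl
    simp only [Program.bound, IntExp.cost]
    omega

/-- Replaces the output by the value in the register `15` if this is smaller and the register `16`
is `0`. -/
def updateOutput : Program :=
  .ite (.and (.intEq (.reg 16) (.const 0))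
    (.not (.and (.not (.intEq (.reg 2) (.const 0))) (.not (.intLt (.reg 15) (.reg 3))))))
    (.setInt 2 (.const 1) ;; .setInt 3 (.reg 15)) .skip

theorem runs_updateOutput (m : Mem) : Runs updateOutput m updateOutput.bound fun m' =>
    output m' = min (if m.intReg 16 = 0 then (m.intReg 15 : ℕ∞) else ⊤) (output m) := by
  refine Runs.of_loopFree rfl ?_
  by_cases c1 : m.intReg 16 = 0 <;> by_cases c2 : m.intReg 2 = 0 <;>
    by_cases c3 : m.intReg 15 < m.intReg 3 <;>
    simp [updateOutput, Program.run, Test.eval, IntExp.eval, output, c1, c2, c3]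
  · exact c3.le
  · omega

/-! ### Second phase: enumerating the tuples in base `n` -/

/-- The digits of `c + 1`. -/
theorem succ_div_pow_mod {n : ℕ} (hn : 0 < n) (c i : ℕ) : (c + 1) / n ^ i % n =
    if n ^ i ∣ c + 1 then if c / n ^ i % n + 1 = n then 0 else c / n ^ i % n + 1
    else c / n ^ i % n := by
  have hlt := Nat.mod_lt (c / n ^ i) hn
  rw [Nat.succ_div]
  split_ifs with h1 h2
  · rw [Nat.add_mod, ← Nat.add_mod, ← Nat.mod_add_mod, h2, Nat.mod_self]
  · rw [← Nat.mod_add_mod, Nat.mod_eq_of_lt (by omega)]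
  · rfl

/-- The rule for the carry: it passes digit `i` exactly when it arrives there and the digit is
maximal. -/
theorem pow_succ_dvd_succ_iff {n : ℕ} (hn : 0 < n) (c i : ℕ) :
    n ^ (i + 1) ∣ c + 1 ↔ n ^ i ∣ c + 1 ∧ c / n ^ i % n + 1 = n := by
  have hlt := Nat.mod_lt (c / n ^ i) hn
  by_cases h : n ^ i ∣ c + 1
  · have h1 : c + 1 = n ^ i * (c / n ^ i + 1) := by
      rw [← Nat.succ_div_of_dvd h, Nat.mul_div_cancel' h]
    simp only [h, true_and]
    conv_lhs => rw [h1, pow_succ]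
    rw [Nat.mul_dvd_mul_iff_left (by positivity), Nat.dvd_iff_mod_eq_zero, ← Nat.mod_add_mod]
    constructor
    · intro h2
      by_contra hne
      rw [Nat.mod_eq_of_lt (by omega)] at h2
      omega
    · intro h2
      rw [h2, Nat.mod_self]
  · simp only [h, false_and, iff_false]
    exact fun h' => h ((pow_dvd_pow n (Nat.le_succ i)).trans h')

/-- Replaces the tuple in the array `9` by the next one. -/
def nextTuple : Program :=
  .setInt 19 (.const 1) ;; forLoop 7 1 (.ite (.intEq (.reg 19) (.const 1))
    (.ite (.intEq (.add (.arr 9 (.reg 7)) (.const 1)) (.reg 0))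
      (.storeInt 9 (.reg 7) (.const 0))
      (.storeInt 9 (.reg 7) (.add (.arr 9 (.reg 7)) (.const 1)) ;; .setInt 19 (.const 0)))
    .skip)

/-- Before digit `i` is treated, the carry in register `19` is 1 exactly when `n ^ i` divides `c +
1`. -/
theorem runs_nextTuple {n k c : ℕ} (hn : 0 < n) {m : Mem} (hn' : m.intReg 0 = n)
    (hk : m.intReg 1 = k) (hd : ∀ a < k, m.intArr 9 a = c / n ^ a % n) :
    Runs nextTuple m (31 * k + 7) fun m' => ∀ a < k, m'.intArr 9 a = (c + 1) / n ^ a % n := by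
  classical
  refine (Runs.seq (Runs.of_loopFree rfl (Q := fun m' => m'.intReg 19 = 1) (by
    simp [Program.run, IntExp.eval])) fun m₁ hF₁ h19 => Runs.forLoop_uniform (b := 24)
    (N := k) rfl rfl rfl ((hF₁.1 1 rfl).trans hk) le_rfl (fun i m' =>
      (m'.intReg 19 = 1 ↔ n ^ i ∣ c + 1) ∧ ∀ a < k, m'.intArr 9 a =
        if a < i then (c + 1) / n ^ a % n else c / n ^ a % n) ?_ ?_ ?_ ?_).imp ?_
      fun _ _ h => h
  · refine ⟨by simp [h19], fun a ha => ?_⟩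
    rw [hF₁.2 9 rfl, hd a ha]
    simp
  · simp
  · rintro i m₂ hi h7 hF₂ ⟨h1, h2⟩
    have e0 : m₂.intReg 0 = n := by rw [hF₂.1 0 rfl, hF₁.1 0 rfl, hn']
    have e9 : m₂.intArr 9 i = c / n ^ i % n := by simpa using h2 i hi
    have hother : ∀ a < k, a ≠ i → m₂.intArr 9 a =
        if a < i + 1 then (c + 1) / n ^ a % n else c / n ^ a % n := fun a ha hai => by
      rw [h2 a ha]
      have : a < i ↔ a < i + 1 := by omega
      simp only [this]
    have hstep := succ_div_pow_mod hn c i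
    refine (Runs.of_loopFree rfl ?_).imp (Q := fun m' =>
      (m'.intReg 19 = 1 ↔ n ^ (i + 1) ∣ c + 1) ∧ ∀ a < k, m'.intArr 9 a =
        if a < i + 1 then (c + 1) / n ^ a % n else c / n ^ a % n) (by decide) fun _ _ h => h
    rw [pow_succ_dvd_succ_iff hn, ← h1]
    simp only [← h1] at hstep
    by_cases c1 : m₂.intReg 19 = 1 <;> by_cases c2 : c / n ^ i % n + 1 = n <;>
      simp [Program.run, Test.eval, IntExp.eval, h7, e0, e9, c1, c2] <;>
      simp only [c1, c2, if_true, if_false] at hstep <;> intro a ha <;> by_cases hai : a = i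
    all_goals first
      | (subst hai; simp [hstep, e9])
      | simpa [hai] using hother a ha hai
  · rintro m' - ⟨-, h⟩ a ha
    rw [h a ha, if_pos ha]
  · simp only [Program.bound, IntExp.cost]
    omega

/-- Computes the resilience from the meeting graph. -/
def resilienceProgram : Program :=
  .setInt 2 (.const 0) ;; countTuples ;;
    forLoop 8 13 (evaluateTuple ;; updateOutput ;; nextTuple)

theorem iInf_tupleCost_eq {n k : ℕ} (H : SimpleGraph (Fin n)) (D : ℕ → Fin k → Fin n)
    (hD : ∀ c a, (D c a : ℕ) = c / n ^ (a : ℕ) % n) :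
    ⨅ d : Fin k → Fin n, H.tupleCost d = (Finset.range (n ^ k)).inf fun c => H.tupleCost (D c) := by
  apply le_antisymm
  · exact Finset.le_inf fun c _ => iInf_le _ _
  · refine le_iInf fun d => ?_
    have h : D (finFunctionFinEquiv d) = d := by
      have h2 := finFunctionFinEquiv.symm_apply_apply d
      funext a
      refine Fin.ext ((hD _ a).trans ?_)
      conv_rhs => rw [← h2]
      rfl
    conv_rhs => rw [← h]
    exact Finset.inf_le (f := fun c => H.tupleCost (D c))
      (Finset.mem_range.2 (finFunctionFinEquiv d).2)

/-- After `c` rounds the output is the minimum over the first `c` tuples. Each of the `n ^ k` rounds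
takes `O(k * n)` steps, dominated by the evaluation. -/
theorem runs_resilienceProgram : ∃ C : ℕ, ∀ (n k : ℕ) (H : SimpleGraph (Fin n)) (m : Mem),
    0 < n → 1 ≤ k → HoldsGraph m H → m.intReg 0 = n → m.intReg 1 = k →
    (∀ i < n, m.intArr 3 i = i * n) → (∀ i, m.intArr 9 i = 0) →
    Runs resilienceProgram m (C * (k * n ^ (k + 1))) fun m' =>
      output m' = ⨅ d : Fin k → Fin n, H.tupleCost d := by
  classical
  set c₀ := updateOutput.bound
  refine ⟨2 + (11 + 16 + 7) + (35 + 36 + 9 + c₀ + 31 + 7 + 7 + 5),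
    fun n k H m hn hk hG h0 h1 htab h9 => ?_⟩
  let D : ℕ → Fin k → Fin n := fun c a => ⟨c / n ^ (a : ℕ) % n, Nat.mod_lt _ hn⟩
  rw [iInf_tupleCost_eq H D fun _ _ => rfl]
  refine (Runs.seq (Runs.of_loopFree rfl (Q := fun m' => m'.intReg 2 = 0) (by
    simp [Program.run, IntExp.eval])) fun m₁ hF₁ h2 =>
    Runs.seq (runs_countTuples ((hF₁.1 0 rfl).trans h0) ((hF₁.1 1 rfl).trans h1))
    fun m₂ hF₂ h13 => Runs.forLoop_uniform
      (b := ((35 * k + 36) * n + 9) + (c₀ + (31 * k + 7)))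
    (N := n ^ k) rfl rfl rfl h13 le_rfl (fun c m' =>
      output m' = ((Finset.range c).inf fun c => H.tupleCost (D c)) ∧
      ∀ a < k, m'.intArr 9 a = c / n ^ a % n) ?_ ?_ ?_ fun _ _ h => h.1).imp ?_ fun _ _ h => h
  · refine ⟨?_, fun a _ => ?_⟩
    -- The flag 0 in register `2` encodes infinity, the infimum over no tuples.
    · simp [output, hF₂.1 2 rfl, h2]
    · rw [hF₂.2 9 rfl, hF₁.2 9 rfl, h9]
      simp
  · simp [output]
  · rintro c m₃ hc - hF₃ ⟨hout, hdig⟩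
    have e0 : m₃.intReg 0 = n := by rw [hF₃.1 0 rfl, hF₂.1 0 rfl, hF₁.1 0 rfl, h0]
    have e1 : m₃.intReg 1 = k := by rw [hF₃.1 1 rfl, hF₂.1 1 rfl, hF₁.1 1 rfl, h1]
    refine Runs.seq (runs_evaluateTuple (H := H) (d := D c) e0 e1 (fun u v => ?_) (fun i hi => ?_)
      fun a => hdig a a.2) fun m₄ hF₄ heval => Runs.seq (runs_updateOutput m₄)
      fun m₅ hF₅ hupd => (runs_nextTuple (c := c) hn ?_ ?_ fun a ha => ?_).imp le_rfl
      fun m₆ hF₆ hdig' => ⟨?_, hdig'⟩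
    · rw [hF₃.2 2 rfl, hF₂.2 2 rfl, hF₁.2 2 rfl, hG u v]
    · rw [hF₃.2 3 rfl, hF₂.2 3 rfl, hF₁.2 3 rfl, htab i hi]
    · rw [hF₅.1 0 rfl, hF₄.1 0 rfl, e0]
    · rw [hF₅.1 1 rfl, hF₄.1 1 rfl, e1]
    · rw [hF₅.2 9 rfl, hF₄.2 9 rfl, hdig a ha]
    · have h6 : output m₆ = output m₅ := by
        rw [output, output, hF₆.1 2 rfl, hF₆.1 3 rfl]
      have h4 : output m₄ = output m₃ := by
        rw [output, output, hF₄.1 2 rfl, hF₄.1 3 rfl]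
      rw [h6, hupd, heval, h4, hout, Finset.range_add_one, Finset.inf_insert]
  · have hN : 1 ≤ n ^ k := Nat.one_le_pow _ _ hn
    set N := n ^ k with hNdef
    have hnN : n ≤ N := Nat.le_self_pow (by omega) n
    have e : k * n ^ (k + 1) = k * (N * n) := by rw [pow_succ]
    rw [e]
    have a1 : 1 ≤ k * (N * n) := Nat.mul_pos hk (Nat.mul_pos hN hn)
    have a2 : k * n ≤ k * (N * n) := Nat.mul_le_mul_left _ (Nat.le_mul_of_pos_left _ hN)
    have a3 : k ≤ k * (N * n) := Nat.le_mul_of_pos_right _ (Nat.mul_pos hN hn)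
    have a4 : N * n ≤ k * (N * n) := Nat.le_mul_of_pos_left _ hk
    have a5 : N ≤ N * n := Nat.le_mul_of_pos_right _ hn
    have a6 : k * N ≤ k * (N * n) := Nat.mul_le_mul_left _ a5
    have a7 : c₀ * N ≤ c₀ * (k * (N * n)) := Nat.mul_le_mul_left _ (a5.trans a4)
    simp only [Program.bound, IntExp.cost]
    nlinarith

end RealRAM

theorem mainTheorem5 :
    ∃ (P Q : RealRAM.Program) (C : ℕ), ∀ (n : ℕ) (S : SCS n) (k : ℕ), 1 ≤ k →
      ∃ (m₁ m₂ : RealRAM.Mem) (T₁ T₂ : ℕ),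
        RealRAM.Exec P (RealRAM.input S k) m₁ T₁ ∧
        RealRAM.HoldsGraph m₁ S.meetingGraph ∧
        T₁ ≤ C * n ^ 2 ∧
        RealRAM.Exec Q m₁ m₂ T₂ ∧
        RealRAM.output m₂ = S.resilience k ∧
        T₁ + T₂ ≤ C * (k * n ^ (k + 1)) := by
  obtain ⟨C₁, h₁⟩ := RealRAM.runs_meetingProgram
  obtain ⟨C₂, h₂⟩ := RealRAM.runs_resilienceProgram
  refine ⟨RealRAM.meetingProgram, RealRAM.resilienceProgram, C₁ + C₂, fun n S k hk => ?_⟩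
  have hn : 0 < n := Fin.pos_iff_nonempty.2 S.connected.nonempty
  obtain ⟨m₁, T₁, he₁, hT₁, hG, h0, h1, htab, h9⟩ := h₁ n S k
  obtain ⟨m₂, T₂, he₂, hT₂, hout⟩ := h₂ n k S.meetingGraph m₁ hn hk hG h0 h1 htab h9
  refine ⟨m₁, m₂, T₁, T₂, he₁, hG, hT₁.trans ?_, he₂, hout.trans (S.resilience_eq k).symm, ?_⟩
  · gcongr
    omega
  -- Since `k ≥ 1`, the time of the first phase is absorbed by that of the second.
  · have : n ^ 2 ≤ k * n ^ (k + 1) :=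
      (Nat.pow_le_pow_right hn (by omega)).trans (Nat.le_mul_of_pos_left _ hk)
    calc T₁ + T₂ ≤ C₁ * n ^ 2 + C₂ * (k * n ^ (k + 1)) := add_le_add hT₁ hT₂
      _ ≤ C₁ * (k * n ^ (k + 1)) + C₂ * (k * n ^ (k + 1)) := by gcongr
      _ = (C₁ + C₂) * (k * n ^ (k + 1)) := by ring
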